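/- Let $K$ be a field. The affine algebra $K[\mathrm{PGL}_2]$ is the degree-$0$ part of $K[x_{11},x_{12},x_{21},x_{22},1/\det]$; the $K$-topology on $\mathrm{PGL}_2(K)$ is the topology whose closed sets are the zero sets of collections of elements of $K[\mathrm{PGL}_2]$. A $K$-Borel subgroup of $\mathrm{PGL}_2(K)$ is a maximal element among the closed connected solvable subgroups for the $K$-topology. Let $p:\mathrm{GL}_2(K)\to\mathrm{PGL}_2(K)$ be the canonical surjection and $\mathrm{Aff}_1(K)=\{p\begin{pmatrix}a&b\\0&1\end{pmatrix}: a\in K^*,\ b\in K\}$. For a monic irreducible polynomial $P=T^2-eT-f\in K[T]$ put $C_P=\begin{pmatrix}0&f\\1&e\end{pmatrix}$ and $$G_P=\{p(aI+bC_P): (a,b)\in K^2\setminus\{(0,0)\}\};$$ for a nonsquare $f\in K$ put $T_f=G_{T^2-f}=\{p\begin{pmatrix}a&bf\\b&a\end{pmatrix}: (a,b)\in K^2\setminus\{(0,0)\}\}$. Below, "$K$-isomorphic" for such groups means isomorphic as linear algebraic groups over $K$, where $G_P$ is regarded as the algebraic subgroup $\{p(aI+bC_P): \det(aI+bC_P)\neq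 0\}$ of $\mathrm{PGL}_2$. (A) (Any field $K$.) For every monic irreducible $P$ of degree $2$, $G_P$ is (well defined and) a subgroup of $\mathrm{PGL}_2(K)$. Any closed connected solvable subgroup of $\mathrm{PGL}_2(K)$ for the $K$-topology is conjugate in $\mathrm{PGL}_2(K)$ to a subgroup of either $\mathrm{Aff}_1(K)$ or $G_P$ for some such $P$. If $P,Q\in K[T]$ are monic irreducible of degree $2$, the following are equivalent: (1) $G_P$ and $G_Q$ are conjugate in $\mathrm{PGL}_2(K)$; (2) $G_P$ and $G_Q$ are $K$-isomorphic; (3) the fields $K[T]/\langle P\rangle$ and $K[T]/\langle Q\rangle$ are $K$-isomorphic. (B) (Any infinite field $K$.) For every monic irreducible $P$ of degree $2$, $G_P$ is a $K$-Borel subgroup of $\mathrm{PGL}_2(K)$ that is not triangularisable (not conjugate to a group of upper triangular classes). The non-triangularisable $K$-Borel subgroups of $\mathrm{PGL}_2(K)$ up to conjugation are in one-to-one correspondence with the quadratic field extensions of $K$ up to $K$-isomorphism, in such a way that the class of $B$ corresponds to the class of $L$ if and only if there is a monic irreducible $P$ of degree $2$ such that $B$ is conjugate to $G_P$ and $L\cong_K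 K[T]/\langle P\rangle$. (C) (Any field $K$ with $\operatorname{char}K\neq 2$.) Any closed connected solvable subgroup of $\mathrm{PGL}_2(K)$ for the $K$-topology is conjugate in $\mathrm{PGL}_2(K)$ to a subgroup of either $\mathrm{Aff}_1(K)$ or $T_f$ for some nonsquare $f\in K$. If $f,g\in K$ are nonsquares, the following are equivalent: (1) $T_f$ and $T_g$ are conjugate in $\mathrm{PGL}_2(K)$; (2) $T_f$ and $T_g$ are $K$-isomorphic; (3) the fields $K(\sqrt f)$ and $K(\sqrt g)$ are $K$-isomorphic; (4) $f/g$ is a square in $K$. -/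

import Mathlib

namespace KBorel

open Polynomial
open scoped MatrixGroups

/-- `F(M) / det(M) ^ m`, where `F` is a polynomial over `K` in the four entries of a matrix and
`M` is an invertible matrix over the extension `L` of `K`. -/
noncomputable def evalFrac (K : Type*) {L : Type*} [Field K] [Field L] [Algebra K L]
    (F : MvPolynomial (Fin 2 × Fin 2) K) (m : ℕ) (M : GL (Fin 2) L) : L :=
  MvPolynomial.aeval (fun p : Fin 2 × Fin 2 => (M : Matrix (Fin 2) (Fin 2) L) p.1 p.2) F
    / (M : Matrix (Fin 2) (Fin 2) L).det ^ m

/-- The functions on `PGL₂(L)` given by the elements of the affine algebra `K[PGL₂]`, which is the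
degree-`0` part of `K[x₁₁, x₁₂, x₂₁, x₂₂, 1/det]`. -/
def IsRegular (K : Type*) {L : Type*} [Field K] [Field L] [Algebra K L]
    (h : PGL(2, L) → L) : Prop :=
  ∃ (m : ℕ) (F : MvPolynomial (Fin 2 × Fin 2) K), F.IsHomogeneous (2 * m) ∧
    ∀ M : GL (Fin 2) L, h (Matrix.ProjGenLinGroup.mk M) = evalFrac K F m M

theorem IsRegular.one (K : Type*) [Field K] : IsRegular K (fun _ : PGL(2, K) => (1 : K)) :=
  ⟨0, 1, MvPolynomial.isHomogeneous_one _ _, fun M => by simp [evalFrac]⟩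

theorem IsRegular.mul {K : Type*} [Field K] {h k : PGL(2, K) → K}
    (hh : IsRegular K h) (hk : IsRegular K k) : IsRegular K (fun x => h x * k x) := by
  obtain ⟨m, F, hF, hF'⟩ := hh
  obtain ⟨n, G, hG, hG'⟩ := hk
  refine ⟨m + n, F * G, ?_, fun M => ?_⟩
  · rw [mul_add]; exact hF.mul hG
  · simp only [hF', hG', evalFrac, map_mul, pow_add, div_mul_div_comm]

/-- The zero set in `PGL₂(K)` of a collection of functions. -/
def zeroSet {K : Type*} [Field K] (S : Set (PGL(2, K) → K)) : Set (PGL(2, K)) :=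
  {x | ∀ h ∈ S, h x = 0}

/-- The (Zariski) `K`-topology on `PGL₂(K)`: the closed sets are the zero sets of collections of
elements of `K[PGL₂]`. -/
@[reducible] def kTopology (K : Type*) [Field K] : TopologicalSpace (PGL(2, K)) :=
  TopologicalSpace.ofClosed
    {Z | ∃ S : Set (PGL(2, K) → K), (∀ h ∈ S, IsRegular K h) ∧ Z = zeroSet S}
    ⟨{fun _ => 1}, by simpa using IsRegular.one K, by simp [zeroSet]⟩
    (by
      intro A hA
      refine ⟨{h | IsRegular K h ∧ ∃ Z ∈ A, ∀ x ∈ Z, h x = 0}, fun h hh => hh.1, ?_⟩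
      ext x
      simp only [Set.mem_sInter, zeroSet, Set.mem_ofPred_eq]
      constructor
      · rintro hx h ⟨-, Z, hZ, hh⟩
        exact hh x (hx Z hZ)
      · intro hx Z hZ
        obtain ⟨S, hS, rfl⟩ := hA hZ
        exact fun h hh => hx h ⟨hS h hh, _, hZ, fun y hy => hy h hh⟩)
    (by
      rintro _ ⟨S, hS, rfl⟩ _ ⟨T, hT, rfl⟩
      refine ⟨{p | ∃ h ∈ S, ∃ k ∈ T, p = fun x => h x * k x}, ?_, ?_⟩
      · rintro _ ⟨h, hh, k, hk, rfl⟩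
        exact (hS h hh).mul (hT k hk)
      · ext x
        simp only [zeroSet, Set.mem_union, Set.mem_ofPred_eq]
        constructor
        · rintro (hx | hx) _ ⟨h, hh, k, hk, rfl⟩
          · simp [hx h hh]
          · simp [hx k hk]
        · intro hx
          by_contra! hc
          obtain ⟨⟨h, hh, hh0⟩, k, hk, hk0⟩ := hc
          exact mul_ne_zero hh0 hk0 (hx _ ⟨h, hh, k, hk, rfl⟩))

/-- Closed connected solvable subgroups of `PGL₂(K)`, for the `K`-topology. -/
structure IsClosedConnectedSolvable {K : Type*} [Field K] (B : Subgroup (PGL(2, K))) : Prop where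
  isClosed : @IsClosed _ (kTopology K) (B : Set (PGL(2, K)))
  isConnected : @IsConnected _ (kTopology K) (B : Set (PGL(2, K)))
  isSolvable : Group.IsSolvable B

/-- `K`-Borel subgroups of `PGL₂(K)`: the maximal closed connected solvable subgroups. -/
def IsKBorel {K : Type*} [Field K] (B : Subgroup (PGL(2, K))) : Prop :=
  Maximal IsClosedConnectedSolvable B

/-- `H` and `H'` are conjugate: `u H u⁻¹ = H'` for some `u`. -/
def AreConj {G : Type*} [Group G] (H H' : Subgroup G) : Prop :=
  ∃ u : G, H.map (MulAut.conj u).toMonoidHom = H'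

/-- `H` is conjugate to a subgroup of `H'`. -/
def IsConjInto {G : Type*} [Group G] (H H' : Subgroup G) : Prop :=
  ∃ H₀ ≤ H', AreConj H H₀

/-- `Aff₁(K)`, the subgroup of the classes of the matrices `(a b; 0 1)` with `a ≠ 0`. -/
def affOne (K : Type*) [Field K] : Subgroup (PGL(2, K)) where
  carrier := {g | ∃ (a b : K) (M : GL (Fin 2) K),
    (M : Matrix (Fin 2) (Fin 2) K) = !![a, b; 0, 1] ∧ Matrix.ProjGenLinGroup.mk M = g}
  mul_mem' := by
    rintro _ _ ⟨a, b, M, hM, rfl⟩ ⟨c, d, N, hN, rfl⟩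
    refine ⟨a * c, a * d + b, M * N, ?_, map_mul _ _ _⟩
    simp [hM, hN]
  one_mem' := ⟨1, 0, 1, by simp [Matrix.one_fin_two], map_one _⟩
  inv_mem' := by
    rintro _ ⟨a, b, M, hM, rfl⟩
    have hd : a ≠ 0 := by simpa [hM] using M.det.ne_zero
    refine ⟨a⁻¹, -(a⁻¹ * b), M⁻¹, ?_, map_inv _ _⟩
    rw [Matrix.coe_units_inv, hM, Matrix.inv_def, Matrix.adjugate_fin_two]
    simp [hd]

/-- A subgroup of `PGL₂(K)` is triangularisable if it is conjugate to a group of (classes of)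
upper triangular matrices. -/
def IsTriangularisable {K : Type*} [Field K] (B : Subgroup (PGL(2, K))) : Prop :=
  ∃ u : PGL(2, K), ∀ g ∈ B, ∃ M : GL (Fin 2) K,
    (M : Matrix (Fin 2) (Fin 2) K) 1 0 = 0 ∧ Matrix.ProjGenLinGroup.mk M = u * g * u⁻¹

/-- The polynomial `P = T² - e T - f`. -/
noncomputable def quadPoly {K : Type*} [Field K] (e f : K) : K[X] := X ^ 2 - C e * X - C f

/-- The companion matrix `C_P` of `P = T² - e T - f`. -/
def companion {L : Type*} [Field L] (e f : L) : Matrix (Fin 2) (Fin 2) L := !![0, f; 1, e]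

theorem smul_one_add_smul_companion {L : Type*} [Field L] (e f a b : L) :
    a • (1 : Matrix (Fin 2) (Fin 2) L) + b • companion e f = !![a, b * f; b, a + b * e] := by
  ext i j
  fin_cases i <;> fin_cases j <;> simp [companion]

/-- The group `G_P` for `P = T² - e T - f`: the classes of the invertible matrices of the form
`a I + b C_P`. -/
def compGroup {L : Type*} [Field L] (e f : L) : Subgroup (PGL(2, L)) where
  carrier := {g | ∃ (a b : L) (M : GL (Fin 2) L), (a, b) ≠ (0, 0) ∧
    (M : Matrix (Fin 2) (Fin 2) L) = a • (1 : Matrix (Fin 2) (Fin 2) L) + b • companion e f ∧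
    Matrix.ProjGenLinGroup.mk M = g}
  mul_mem' := by
    rintro _ _ ⟨a, b, M, -, hM, rfl⟩ ⟨c, d, N, -, hN, rfl⟩
    have h : ((M * N : GL (Fin 2) L) : Matrix (Fin 2) (Fin 2) L) =
        (a * c + b * d * f) • (1 : Matrix (Fin 2) (Fin 2) L) +
          (a * d + b * c + b * d * e) • companion e f := by
      rw [Units.val_mul, hM, hN]
      simp only [smul_one_add_smul_companion]
      ext i j
      fin_cases i <;> fin_cases j <;> simp [Matrix.mul_apply] <;> ring
    refine ⟨_, _, M * N, ?_, h, map_mul _ _ _⟩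
    intro h0
    rw [Prod.mk.injEq] at h0
    rw [h0.1, h0.2, zero_smul, zero_smul, add_zero] at h
    exact (M * N).ne_zero h
  one_mem' := ⟨1, 0, 1, by simp, by simp, map_one _⟩
  inv_mem' := by
    rintro _ ⟨a, b, M, -, hM, rfl⟩
    have h : ((M⁻¹ : GL (Fin 2) L) : Matrix (Fin 2) (Fin 2) L) =
        ((M : Matrix (Fin 2) (Fin 2) L).det⁻¹ * (a + b * e)) • (1 : Matrix (Fin 2) (Fin 2) L) +
          (-((M : Matrix (Fin 2) (Fin 2) L).det⁻¹ * b)) • companion e f := by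
      rw [Matrix.coe_units_inv, Matrix.inv_def, Ring.inverse_eq_inv']
      generalize (M : Matrix (Fin 2) (Fin 2) L).det⁻¹ = t
      rw [hM]
      simp only [smul_one_add_smul_companion, Matrix.adjugate_fin_two]
      ext i j
      fin_cases i <;> fin_cases j <;> simp <;> ring
    refine ⟨_, _, M⁻¹, ?_, h, map_inv _ _⟩
    intro h0
    rw [Prod.mk.injEq] at h0
    rw [h0.1, h0.2, zero_smul, zero_smul, add_zero] at h
    exact (M⁻¹).ne_zero h

/-- The group `T_f`: the classes of the invertible matrices `(a bf; b a)`; it is `G_P` for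
`P = T² - f`. -/
def torus {L : Type*} [Field L] (f : L) : Subgroup (PGL(2, L)) := compGroup 0 f

theorem mem_torus_iff {L : Type*} [Field L] (f : L) (g : PGL(2, L)) :
    g ∈ torus f ↔ ∃ (a b : L) (M : GL (Fin 2) L), (a, b) ≠ (0, 0) ∧
      (M : Matrix (Fin 2) (Fin 2) L) = !![a, b * f; b, a] ∧
      Matrix.ProjGenLinGroup.mk M = g := by
  change (∃ (a b : L) (M : GL (Fin 2) L), _) ↔ _
  simp only [smul_one_add_smul_companion, mul_zero, add_zero]

/-- The elements of the affine algebra `K[H]` of a closed subgroup `H` of `PGL₂` over an algebraic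
closure `K̄` of `K`: the restrictions to `H` of the elements of `K[PGL₂]`. -/
def IsRegularOn (K : Type*) [Field K] (H : Subgroup (PGL(2, AlgebraicClosure K)))
    (φ : H → AlgebraicClosure K) : Prop :=
  ∃ h : PGL(2, AlgebraicClosure K) → AlgebraicClosure K,
    IsRegular K h ∧ ∀ x : H, φ x = h x

/-- `K`-isomorphism of linear algebraic groups (given by their groups of `K̄`-points): a group
isomorphism `ψ` such that `ψ` and `ψ⁻¹` are morphisms of varieties defined over `K`, that is,
composition with them maps the affine `K`-algebras to each other. -/
def AreKIsomorphic (K : Type*) [Field K] (H H' : Subgroup (PGL(2, AlgebraicClosure K))) : Prop :=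
  ∃ ψ : H ≃* H',
    (∀ φ, IsRegularOn K H' φ → IsRegularOn K H (fun x => φ (ψ x))) ∧
    (∀ φ, IsRegularOn K H φ → IsRegularOn K H' (fun x => φ (ψ.symm x)))

/-- `G_P`, for `P = T² - e T - f` over `K`, as an algebraic subgroup of `PGL₂` over `K`. -/
noncomputable def compAlgGroup {K : Type*} [Field K] (e f : K) :
    Subgroup (PGL(2, AlgebraicClosure K)) :=
  compGroup (algebraMap K (AlgebraicClosure K) e) (algebraMap K (AlgebraicClosure K) f)

/-- `T_f`, for `f` in `K`, as an algebraic subgroup of `PGL₂` over `K`. -/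
noncomputable def torusAlgGroup {K : Type*} [Field K] (f : K) :
    Subgroup (PGL(2, AlgebraicClosure K)) :=
  torus (algebraMap K (AlgebraicClosure K) f)

/-- The `K`-Borel subgroups of `PGL₂(K)` that are not triangularisable. -/
def NontrivialKBorel (K : Type*) [Field K] : Type _ :=
  {B : Subgroup (PGL(2, K)) // IsKBorel B ∧ ¬ IsTriangularisable B}

theorem AreConj.equivalence (G : Type*) [Group G] :
    Equivalence (AreConj : Subgroup G → Subgroup G → Prop) where
  refl H := ⟨1, by ext; simp⟩
  symm := by
    rintro H _ ⟨u, rfl⟩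
    refine ⟨u⁻¹, ?_⟩
    ext x
    simp [Subgroup.mem_map, mul_assoc]
  trans := by
    rintro H _ _ ⟨u, rfl⟩ ⟨v, rfl⟩
    refine ⟨v * u, ?_⟩
    ext x
    simp [Subgroup.mem_map, mul_assoc]

/-- Conjugacy of non-triangularisable `K`-Borel subgroups. -/
def conjSetoid (K : Type*) [Field K] : Setoid (NontrivialKBorel K) where
  r B B' := AreConj B.1 B'.1
  iseqv :=
    ⟨fun B => (AreConj.equivalence _).refl B.1, fun h => (AreConj.equivalence _).symm h,
      fun h h' => (AreConj.equivalence _).trans h h'⟩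

/-- Quadratic field extensions of `K`. -/
structure QuadExt.{u} (K : Type u) [Field K] : Type (u + 1) where
  carrier : Type u
  [field : Field carrier]
  [algebra : Algebra K carrier]
  finrank_eq_two : Module.finrank K carrier = 2

attribute [instance] QuadExt.field QuadExt.algebra

/-- `K`-isomorphism of quadratic extensions of `K`. -/
def isoSetoid.{u} (K : Type u) [Field K] : Setoid (QuadExt K) where
  r E E' := Nonempty (E.carrier ≃ₐ[K] E'.carrier)
  iseqv :=
    ⟨fun _ => ⟨AlgEquiv.refl⟩, fun ⟨s⟩ => ⟨s.symm⟩, fun ⟨s⟩ ⟨t⟩ => ⟨s.trans t⟩⟩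

end KBorel

namespace KBorel

open Polynomial Matrix
open scoped MatrixGroups Topology commutatorElement

/-! ### Regular functions and the `K`-topology -/

/-! Classification. Let `B` be connected, solvable and nontrivial. The last nontrivial term `A` of
its derived series is connected, commutative and normalised by `B`
(`exists_connected_commutative_normal`). Lift a nontrivial element of `A` to a nonscalar matrix `M`.
Matrices whose classes commute with that of `M` commute or anticommute with `M`. These are two
linear conditions, so connectedness selects the one that holds at the identity
(`commute_of_isPreconnected`). Hence `A` lies in the classes of `K[M]`, and `B` normalises `K[M]`.
If the characteristic polynomial of `M` has a root, connectedness makes `B` fix an eigenline of `M`,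
so `B` goes into `Aff₁`. Otherwise `K[M]` is a field on which `B` acts by automorphisms,
connectedness makes the action trivial, and `B` lies in the classes of the centraliser `K[M]`, which
is conjugate to some `G_P`.

Equivalences. A conjugating matrix has entries in `K`, so conjugacy gives a `K`-isomorphism. A root
`x + yα` of `Q` in `K[T]/P` gives the matrix `xI + yC_P` with characteristic polynomial `Q`, and
similarity to `C_Q` gives conjugacy. The remaining implication views `G_Q` as the conic `uw = v²`,
`u + e'v - f'w = 1`, whose points at infinity correspond to roots of `Q`. Pulling its coordinates
back along `t ↦ tI + C_P` produces a point at infinity over `K[T]/P`, unless the pullback is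
constant, which injectivity excludes (`nonempty_algEquiv_of_areKIsomorphic`).

Borel subgroups. Over an infinite field `G_P` is closed, connected and commutative, and
irreducibility of `P` prevents triangularisation. A larger closed connected solvable group is then
conjugate into some commutative `G_{P'}`, so it centralises `C_P` and equals `G_P`. -/

theorem mk_eq_mk_iff {L : Type*} [Field L] {M N : GL (Fin 2) L} :
    ProjGenLinGroup.mk M = ProjGenLinGroup.mk N ↔
      ∃ c : L, c ≠ 0 ∧ (N : Matrix (Fin 2) (Fin 2) L) = c • (M : Matrix (Fin 2) (Fin 2) L) := by
  rw [ProjGenLinGroup.mk_eq_mk_iff]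
  constructor
  · rintro ⟨u, rfl⟩
    refine ⟨u, u.ne_zero, ?_⟩
    ext i j
    simp [Matrix.scalar_apply, mul_comm]
  · rintro ⟨c, hc, h⟩
    refine ⟨Units.mk0 c hc, Units.ext ?_⟩
    rw [h]
    ext i j
    simp [Matrix.scalar_apply, mul_comm]

theorem det_ne_zero_GL {L : Type*} [Field L] (M : GL (Fin 2) L) :
    (M : Matrix (Fin 2) (Fin 2) L).det ≠ 0 := by
  simpa using M.det.ne_zero

theorem aeval_smul_of_isHomogeneous {σ K L : Type*} [Field K] [Field L] [Algebra K L]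
    {F : MvPolynomial σ K} {n : ℕ} (hF : F.IsHomogeneous n) (c : L) (x : σ → L) :
    MvPolynomial.aeval (fun i => c * x i) F = c ^ n * MvPolynomial.aeval x F := by
  rw [MvPolynomial.aeval_def, MvPolynomial.aeval_def, MvPolynomial.eval₂_eq, MvPolynomial.eval₂_eq,
    Finset.mul_sum]
  refine Finset.sum_congr rfl fun d hd => ?_
  have h := hF (MvPolynomial.mem_support_iff.1 hd)
  have h' : ∑ i ∈ d.support, d i = n := by
    rw [← h, Finsupp.weight_apply, Finsupp.sum]
    simp
  simp only [mul_pow, Finset.prod_mul_distrib, Finset.prod_pow_eq_pow_sum, h']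
  ring

/-- Scaling a lift by `c` multiplies both `F` and `det ^ m` by `c ^ (2 * m)`, so the quotient does
not depend on the lift. -/
theorem exists_isRegular {K L : Type*} [Field K] [Field L] [Algebra K L] (m : ℕ)
    {F : MvPolynomial (Fin 2 × Fin 2) K} (hF : F.IsHomogeneous (2 * m)) :
    ∃ h : PGL(2, L) → L, IsRegular K h ∧
      ∀ M : GL (Fin 2) L, h (ProjGenLinGroup.mk M) = evalFrac K F m M := by
  have key : ∀ M : GL (Fin 2) L,
      evalFrac K F m (Function.surjInv ProjGenLinGroup.mk_surjective (ProjGenLinGroup.mk M)) =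
        evalFrac K F m M := by
    intro M
    obtain ⟨c, hc, h⟩ := mk_eq_mk_iff.1 (Function.surjInv_eq ProjGenLinGroup.mk_surjective
      (ProjGenLinGroup.mk M)).symm
    unfold evalFrac
    rw [h]
    simp only [Matrix.smul_apply, smul_eq_mul, aeval_smul_of_isHomogeneous hF, Matrix.det_smul,
      Fintype.card_fin, mul_pow, ← pow_mul]
    rw [mul_div_mul_left _ _ (pow_ne_zero _ hc)]
  exact ⟨fun x => evalFrac K F m (Function.surjInv ProjGenLinGroup.mk_surjective x),
    ⟨m, F, hF, key⟩, key⟩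

/-- The pullback of a regular function along a map that is given by homogeneous polynomials in the
matrix entries is regular. -/
theorem IsRegular.comp_polynomialMap {K L : Type*} [Field K] [Field L] [Algebra K L]
    {h : PGL(2, L) → L} (hh : IsRegular K h) {φ : PGL(2, L) → PGL(2, L)} (d : ℕ) (k : K)
    (Q : Matrix (Fin 2) (Fin 2) (MvPolynomial (Fin 2 × Fin 2) K))
    (hQ : ∀ i j, (Q i j).IsHomogeneous d)
    (hφ : ∀ M : GL (Fin 2) L, ∃ N : GL (Fin 2) L,
      φ (ProjGenLinGroup.mk M) = ProjGenLinGroup.mk N ∧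
      (N : Matrix (Fin 2) (Fin 2) L) =
        Q.map (MvPolynomial.aeval fun p => (M : Matrix (Fin 2) (Fin 2) L) p.1 p.2) ∧
      (N : Matrix (Fin 2) (Fin 2) L).det =
        algebraMap K L k * (M : Matrix (Fin 2) (Fin 2) L).det ^ d) :
    IsRegular K (fun x => h (φ x)) := by
  obtain ⟨m, F, hF, hh⟩ := hh
  -- The denominator `det N ^ m` equals `k ^ m * det M ^ (d * m)`; the constant factor is moved into
  -- the numerator.
  refine ⟨d * m, MvPolynomial.C (k ^ m)⁻¹ * MvPolynomial.aeval (fun p => Q p.1 p.2) F, ?_, ?_⟩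
  · have := (MvPolynomial.isHomogeneous_C (Fin 2 × Fin 2) (k ^ m)⁻¹).mul
      (hF.aeval _ fun p => hQ p.1 p.2)
    convert this using 1
    ring
  · intro M
    obtain ⟨N, h1, h2, h3⟩ := hφ M
    simp only [h1, hh, evalFrac, h3, map_mul, MvPolynomial.aeval_C]
    have : MvPolynomial.aeval (fun p : Fin 2 × Fin 2 => (N : Matrix (Fin 2) (Fin 2) L) p.1 p.2) F =
        MvPolynomial.aeval (fun p : Fin 2 × Fin 2 => (M : Matrix (Fin 2) (Fin 2) L) p.1 p.2)
          (MvPolynomial.aeval (fun p => Q p.1 p.2) F) := by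
      rw [← AlgHom.comp_apply, MvPolynomial.comp_aeval]
      simp only [h2, Matrix.map_apply]
    rw [this, mul_pow, ← pow_mul, map_inv₀, map_pow, mul_comm ((algebraMap K L k ^ m)⁻¹),
      ← div_eq_mul_inv, div_div]

/-- The generic `2 × 2` matrix. -/
noncomputable def genMat (K : Type*) [Field K] :
    Matrix (Fin 2) (Fin 2) (MvPolynomial (Fin 2 × Fin 2) K) :=
  Matrix.of fun i j => MvPolynomial.X (i, j)

/-- A constant matrix with polynomial entries. -/
noncomputable def constMat {K : Type*} [Field K] (U : Matrix (Fin 2) (Fin 2) K) :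
    Matrix (Fin 2) (Fin 2) (MvPolynomial (Fin 2 × Fin 2) K) :=
  U.map MvPolynomial.C

theorem map_genMat {K L : Type*} [Field K] [Field L] [Algebra K L]
    (M : Matrix (Fin 2) (Fin 2) L) :
    (genMat K).map (MvPolynomial.aeval fun p => M p.1 p.2) = M := by
  ext i j
  simp [genMat]

theorem map_adjugate_genMat {K L : Type*} [Field K] [Field L] [Algebra K L]
    (M : Matrix (Fin 2) (Fin 2) L) :
    (genMat K).adjugate.map (MvPolynomial.aeval fun p => M p.1 p.2) = M.adjugate := by
  ext i j
  fin_cases i <;> fin_cases j <;> simp [genMat, Matrix.adjugate_fin_two]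

theorem map_constMat {K L : Type*} [Field K] [Field L] [Algebra K L]
    (M : Fin 2 × Fin 2 → L) (U : Matrix (Fin 2) (Fin 2) K) :
    (constMat U).map (MvPolynomial.aeval M) = U.map (algebraMap K L) := by
  ext i j
  simp [constMat]

theorem isHomogeneous_genMat (K : Type*) [Field K] (i j : Fin 2) :
    (genMat K i j).IsHomogeneous 1 :=
  MvPolynomial.isHomogeneous_X _ _

theorem isHomogeneous_adjugate_genMat (K : Type*) [Field K] (i j : Fin 2) :
    ((genMat K).adjugate i j).IsHomogeneous 1 := by
  rw [Matrix.adjugate_fin_two]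
  fin_cases i <;> fin_cases j <;> simp only [Matrix.of_apply, Fin.zero_eta, Fin.mk_one,
    Matrix.cons_val', Matrix.cons_val_zero, Matrix.cons_val_one, Matrix.cons_val_fin_one]
  exacts [isHomogeneous_genMat K _ _, (isHomogeneous_genMat K _ _).neg,
    (isHomogeneous_genMat K _ _).neg, isHomogeneous_genMat K _ _]

theorem isHomogeneous_constMat {K : Type*} [Field K] (U : Matrix (Fin 2) (Fin 2) K) (i j : Fin 2) :
    (constMat U i j).IsHomogeneous 0 :=
  MvPolynomial.isHomogeneous_C _ _

theorem isHomogeneous_matrix_mul {K : Type*} [Field K]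
    {Q R : Matrix (Fin 2) (Fin 2) (MvPolynomial (Fin 2 × Fin 2) K)} {m n : ℕ}
    (hQ : ∀ i j, (Q i j).IsHomogeneous m) (hR : ∀ i j, (R i j).IsHomogeneous n) (i j : Fin 2) :
    ((Q * R) i j).IsHomogeneous (m + n) := by
  rw [Matrix.mul_apply]
  exact MvPolynomial.IsHomogeneous.sum _ _ _ fun k _ => (hQ i k).mul (hR k j)

/-- The image in `GL₂(L)` of a matrix in `GL₂(K)`. -/
noncomputable abbrev baseChange {K : Type*} (L : Type*) [Field K] [Field L] [Algebra K L]
    (U : GL (Fin 2) K) : GL (Fin 2) L :=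
  GeneralLinearGroup.map (algebraMap K L) U

theorem coe_baseChange {K L : Type*} [Field K] [Field L] [Algebra K L] (U : GL (Fin 2) K) :
    (baseChange L U : Matrix (Fin 2) (Fin 2) L) =
      (U : Matrix (Fin 2) (Fin 2) K).map (algebraMap K L) := rfl

theorem det_map_algebraMap {K L : Type*} [Field K] [Field L] [Algebra K L]
    (U : Matrix (Fin 2) (Fin 2) K) : (U.map (algebraMap K L)).det = algebraMap K L U.det := by
  simp [Matrix.det_fin_two]

theorem IsRegular.comp_mul {K L : Type*} [Field K] [Field L] [Algebra K L]
    {h : PGL(2, L) → L} (hh : IsRegular K h) (U V : GL (Fin 2) K) :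
    IsRegular K (fun x => h (ProjGenLinGroup.mk (baseChange L U) * x *
      ProjGenLinGroup.mk (baseChange L V))) := by
  refine hh.comp_polynomialMap (0 + 1 + 0) (U.val.det * V.val.det)
    (constMat U.val * genMat K * constMat V.val)
    (isHomogeneous_matrix_mul (isHomogeneous_matrix_mul (isHomogeneous_constMat _)
      (isHomogeneous_genMat K)) (isHomogeneous_constMat _)) fun M => ?_
  refine ⟨baseChange L U * M * baseChange L V, by simp only [map_mul], ?_, ?_⟩
  · rw [Matrix.map_mul, Matrix.map_mul, map_genMat, map_constMat, map_constMat]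
    rfl
  · simp only [Units.val_mul, Matrix.det_mul, coe_baseChange, det_map_algebraMap, map_mul]
    ring

theorem mk_baseChange_self {K : Type*} [Field K] (U : GL (Fin 2) K) : baseChange K U = U := by
  ext i j
  simp

/-- In `PGL₂` the inverse of `M` may be replaced by its adjugate, which is polynomial. The
representative `M U adj(M) U⁻¹` is `det M` times a commutator, which has determinant `1`; hence
degree `2` and constant `1`. -/
theorem IsRegular.comp_commutator {K : Type*} [Field K]
    {h : PGL(2, K) → K} (hh : IsRegular K h) (U : GL (Fin 2) K) :
    IsRegular K (fun x => h ⁅x, ProjGenLinGroup.mk U⁆) := by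
  refine hh.comp_polynomialMap (1 + 0 + 1 + 0) 1
    (genMat K * constMat U.val * (genMat K).adjugate * constMat (U⁻¹).val)
    (isHomogeneous_matrix_mul (isHomogeneous_matrix_mul (isHomogeneous_matrix_mul
      (isHomogeneous_genMat K) (isHomogeneous_constMat _)) (isHomogeneous_adjugate_genMat K))
        (isHomogeneous_constMat _)) fun M => ?_
  have hM := det_ne_zero_GL M
  have hadj : M.val.adjugate = M.val.det • (M⁻¹).val := by
    rw [Matrix.coe_units_inv, Matrix.inv_def, Ring.inverse_eq_inv', smul_smul, mul_inv_cancel₀ hM,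
      one_smul]
  have hval : M.val.det • (⁅M, U⁆ : GL (Fin 2) K).val =
      M.val * U.val * M.val.adjugate * (U⁻¹).val := by
    rw [hadj, commutatorElement_def]
    simp only [Units.val_mul, Matrix.mul_smul, Matrix.smul_mul]
  refine ⟨GeneralLinearGroup.mkOfDetNeZero (M.val.det • (⁅M, U⁆ : GL (Fin 2) K).val) ?_, ?_, ?_, ?_⟩
  · rw [Matrix.det_smul]
    exact mul_ne_zero (pow_ne_zero _ hM) (det_ne_zero_GL _)
  · rw [← map_commutatorElement, mk_eq_mk_iff]
    exact ⟨_, hM, rfl⟩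
  · change M.val.det • (⁅M, U⁆ : GL (Fin 2) K).val = _
    simp only [Matrix.map_mul, map_genMat, map_constMat, map_adjugate_genMat, hval]
    congr 1
  · change (M.val.det • (⁅M, U⁆ : GL (Fin 2) K).val).det = _
    have : (⁅M, U⁆ : GL (Fin 2) K).val.det = 1 := by
      have := map_commutatorElement (GeneralLinearGroup.det (n := Fin 2) (R := K)) M U
      have h1 : ⁅GeneralLinearGroup.det M, GeneralLinearGroup.det U⁆ = 1 :=
        commutatorElement_eq_one_iff_mul_comm.2 (mul_comm _ _)
      rw [h1] at this
      exact congrArg Units.val this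
    rw [Matrix.det_smul, this]
    simp

theorem isClosed_kTopology_iff {K : Type*} [Field K] {Z : Set (PGL(2, K))} :
    IsClosed[kTopology K] Z ↔
      ∃ S : Set (PGL(2, K) → K), (∀ h ∈ S, IsRegular K h) ∧ Z = zeroSet S := by
  rw [← @isOpen_compl_iff _ _ (kTopology K)]
  change Zᶜᶜ ∈ {Z | ∃ S : Set (PGL(2, K) → K), (∀ h ∈ S, IsRegular K h) ∧ Z = zeroSet S} ↔ _
  rw [compl_compl]
  rfl

theorem continuous_kTopology {K : Type*} [Field K] {φ : PGL(2, K) → PGL(2, K)}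
    (hφ : ∀ h : PGL(2, K) → K, IsRegular K h → IsRegular K (fun x => h (φ x))) :
    @Continuous _ _ (kTopology K) (kTopology K) φ := by
  let _ := kTopology K
  rw [continuous_iff_isClosed]
  intro Z hZ
  obtain ⟨S, hS, rfl⟩ := isClosed_kTopology_iff.1 hZ
  refine isClosed_kTopology_iff.2 ⟨(fun h x => h (φ x)) '' S, ?_, ?_⟩
  · rintro _ ⟨h, hh, rfl⟩
    exact hφ h (hS h hh)
  · ext x
    simp [zeroSet]

theorem continuous_mul_mul {K : Type*} [Field K] (u v : PGL(2, K)) :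
    @Continuous _ _ (kTopology K) (kTopology K) (fun x => u * x * v) := by
  obtain ⟨U, rfl⟩ := ProjGenLinGroup.mk_surjective u
  obtain ⟨V, rfl⟩ := ProjGenLinGroup.mk_surjective v
  exact continuous_kTopology fun h hh => by simpa only [mk_baseChange_self] using hh.comp_mul U V

theorem continuous_commutator_left {K : Type*} [Field K] (u : PGL(2, K)) :
    @Continuous _ _ (kTopology K) (kTopology K) (fun x => ⁅x, u⁆) := by
  obtain ⟨U, rfl⟩ := ProjGenLinGroup.mk_surjective u
  exact continuous_kTopology fun h hh => hh.comp_commutator U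

/-- The set of the classes of the invertible matrices killed by a linear form is closed. -/
theorem isClosed_setOf_linearForm {K : Type*} [Field K]
    (l : Matrix (Fin 2) (Fin 2) K →ₗ[K] K) :
    IsClosed[kTopology K] {x : PGL(2, K) | ∃ N : GL (Fin 2) K, ProjGenLinGroup.mk N = x ∧
      l N.val = 0} := by
  -- Numerators of regular functions have even degree, so the linear form is squared; the zeros stay
  -- the same.
  have hhom : ((∑ p : Fin 2 × Fin 2, MvPolynomial.C (l (Matrix.single p.1 p.2 1)) *
      MvPolynomial.X p : MvPolynomial (Fin 2 × Fin 2) K) ^ 2).IsHomogeneous (2 * 1) := by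
    rw [mul_comm]
    refine MvPolynomial.IsHomogeneous.pow (MvPolynomial.IsHomogeneous.sum _ _ _ fun p _ => ?_) 2
    simpa using (MvPolynomial.isHomogeneous_C (Fin 2 × Fin 2) (l (Matrix.single p.1 p.2 1))).mul
      (MvPolynomial.isHomogeneous_X K p)
  obtain ⟨h, hh, hev⟩ := exists_isRegular (L := K) 1 hhom
  have hl : ∀ N : Matrix (Fin 2) (Fin 2) K,
      ∑ p : Fin 2 × Fin 2, l (Matrix.single p.1 p.2 1) * N p.1 p.2 = l N := by
    intro N
    conv_rhs => rw [Matrix.matrix_eq_sum_single N]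
    simp only [map_sum, Fintype.sum_prod_type]
    refine Finset.sum_congr rfl fun i _ => Finset.sum_congr rfl fun j _ => ?_
    rw [← mul_one (N i j), ← smul_eq_mul (N i j) 1, ← Matrix.smul_single, map_smul]
    simp [mul_comm]
  have hz : ∀ N : GL (Fin 2) K, h (ProjGenLinGroup.mk N) = 0 ↔ l N.val = 0 := by
    intro N
    rw [hev, evalFrac, div_eq_zero_iff]
    simp [hl, det_ne_zero_GL N]
  refine isClosed_kTopology_iff.2 ⟨{h}, by simpa using hh, ?_⟩
  ext x
  simp only [zeroSet, Set.mem_singleton_iff, forall_eq]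
  constructor
  · rintro ⟨N, rfl, hN⟩
    exact (hz N).2 hN
  · obtain ⟨N, rfl⟩ := ProjGenLinGroup.mk_surjective x
    exact fun hx => ⟨N, rfl, (hz N).1 hx⟩

/-- A set of classes of invertible matrices that is defined by linear equations is closed. -/
theorem isClosed_setOf_linearMap {K ι : Type*} [Field K]
    (l : Matrix (Fin 2) (Fin 2) K →ₗ[K] (ι → K)) :
    IsClosed[kTopology K] {x : PGL(2, K) | ∃ N : GL (Fin 2) K, ProjGenLinGroup.mk N = x ∧
      l N.val = 0} := by
  let _ := kTopology K
  convert isClosed_iInter fun i => isClosed_setOf_linearForm ((LinearMap.proj i).comp l) using 1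
  ext x
  simp only [Set.mem_iInter]
  constructor
  · rintro ⟨N, rfl, hN⟩ i
    exact ⟨N, rfl, by simp [hN]⟩
  · obtain ⟨N, rfl⟩ := ProjGenLinGroup.mk_surjective x
    intro hx
    refine ⟨N, rfl, funext fun i => ?_⟩
    obtain ⟨N', h, h'⟩ := hx i
    obtain ⟨c, hc, hN'⟩ := mk_eq_mk_iff.1 h
    rw [hN', map_smul, ← smul_zero c] at *
    simp only [LinearMap.comp_apply, LinearMap.proj_apply] at h'
    simp_all

/-! ### Connected solvable subgroups -/

theorem isPreconnected_image_mul_mul {K : Type*} [Field K] {s : Set (PGL(2, K))}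
    (hs : @IsPreconnected _ (kTopology K) s) (u v : PGL(2, K)) :
    @IsPreconnected _ (kTopology K) ((fun x => u * x * v) '' s) := by
  let _ := kTopology K
  exact hs.image _ (continuous_mul_mul u v).continuousOn

/-- Every element is joined to `1` inside `⁅H, H⁆`: a commutator `⁅a, b⁆` by the image of `H` under
`x ↦ ⁅x, b⁆`, products and inverses by translating such sets. Only maps of one variable need to be
continuous, so no joint continuity of multiplication enters. -/
theorem isPreconnected_commutator {K : Type*} [Field K] {H : Subgroup (PGL(2, K))}
    (hH : @IsPreconnected _ (kTopology K) (H : Set (PGL(2, K)))) :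
    @IsPreconnected _ (kTopology K) ((⁅H, H⁆ : Subgroup (PGL(2, K))) : Set (PGL(2, K))) := by
  let _ := kTopology K
  refine isPreconnected_of_forall 1 fun y hy => ?_
  have translate : ∀ x ∈ ⁅H, H⁆, ∀ t : Set (PGL(2, K)), t ⊆ (⁅H, H⁆ : Subgroup (PGL(2, K))) →
      IsPreconnected t → (fun z => x * z * 1) '' t ⊆ (⁅H, H⁆ : Subgroup (PGL(2, K))) ∧
        IsPreconnected ((fun z => x * z * 1) '' t) := by
    intro x hx t ht ht'
    refine ⟨?_, isPreconnected_image_mul_mul ht' x 1⟩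
    rintro _ ⟨z, hz, rfl⟩
    simpa using mul_mem hx (ht hz)
  rw [SetLike.mem_coe, Subgroup.commutator_def] at hy
  induction hy using Subgroup.closure_induction with
  | mem x hx =>
    obtain ⟨a, ha, b, hb, rfl⟩ := hx
    refine ⟨(fun x => ⁅x, b⁆) '' H, ?_, ⟨1, one_mem _, by simp⟩, ⟨a, ha, rfl⟩,
      hH.image _ (continuous_commutator_left b).continuousOn⟩
    rintro _ ⟨c, hc, rfl⟩
    exact Subgroup.commutator_mem_commutator hc hb
  | one => exact ⟨{1}, by simp [one_mem], by simp, by simp, isPreconnected_singleton⟩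
  | mul x y hx hy ihx ihy =>
    obtain ⟨t, ht, h1, hxt, hpt⟩ := ihx
    obtain ⟨s, hs, h1', hys, hps⟩ := ihy
    obtain ⟨h3, h4⟩ := translate x (ht hxt) s hs hps
    refine ⟨t ∪ (fun z => x * z * 1) '' s, Set.union_subset ht h3, Or.inl h1,
      Or.inr ⟨y, hys, by simp⟩, hpt.union x hxt ⟨1, h1', by simp⟩ h4⟩
  | inv x hx ihx =>
    obtain ⟨t, ht, h1, hxt, hpt⟩ := ihx
    obtain ⟨h3, h4⟩ := translate x⁻¹ (inv_mem (ht hxt)) t ht hpt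
    exact ⟨_, h3, ⟨x, hxt, by simp⟩, ⟨1, h1, by simp⟩, h4⟩

/-- A nontrivial connected solvable subgroup has a nontrivial connected commutative normal
subgroup. -/
theorem exists_connected_commutative_normal {K : Type*} [Field K] {B : Subgroup (PGL(2, K))}
    (hB : @IsPreconnected _ (kTopology K) (B : Set (PGL(2, K)))) (hs : Group.IsSolvable B)
    (hne : B ≠ ⊥) :
    ∃ A : Subgroup (PGL(2, K)), A ≠ ⊥ ∧
      @IsPreconnected _ (kTopology K) (A : Set (PGL(2, K))) ∧
      (∀ a ∈ A, ∀ b ∈ A, a * b = b * a) ∧ ∀ b ∈ B, ∀ a ∈ A, b * a * b⁻¹ ∈ A := by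
  classical
  have hsucc : ∀ n, (derivedSeries B (n + 1)).map B.subtype =
      ⁅(derivedSeries B n).map B.subtype, (derivedSeries B n).map B.subtype⁆ := fun n => by
    rw [derivedSeries_succ, Subgroup.map_commutator]
  have hex : ∃ n, (derivedSeries B n).map B.subtype = ⊥ := by
    obtain ⟨n, hn⟩ := hs.solvable
    exact ⟨n, by rw [hn, Subgroup.map_bot]⟩
  have hconn : ∀ n, @IsPreconnected _ (kTopology K)
      ((derivedSeries B n).map B.subtype : Set (PGL(2, K))) := by
    intro n
    induction n with
    | zero => simpa using hB
    | succ n ih =>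
      have := isPreconnected_commutator (H := (derivedSeries B n).map B.subtype) ih
      rw [← hsucc] at this
      exact this
  have h0 : Nat.find hex ≠ 0 := by
    intro h
    have := Nat.find_spec hex
    rw [h, derivedSeries_zero, ← MonoidHom.range_eq_map, Subgroup.range_subtype] at this
    exact hne this
  obtain ⟨n, hn⟩ := Nat.exists_eq_succ_of_ne_zero h0
  -- Term `n + 1` is the first trivial one, so term `n` is nontrivial with trivial commutator
  -- subgroup.
  refine ⟨(derivedSeries B n).map B.subtype, Nat.find_min hex (by omega), hconn n, ?_, ?_⟩
  · have := Nat.find_spec hex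
    rw [hn, Nat.succ_eq_add_one, hsucc, Subgroup.commutator_eq_bot_iff_le_centralizer] at this
    exact fun a ha b hb => (Subgroup.mem_centralizer_iff.1 (this hb) a ha)
  · rintro b hb _ ⟨a, ha, rfl⟩
    have := (derivedSeries_normal B n).conj_mem a ha ⟨b, hb⟩
    exact ⟨_, this, by simp⟩

theorem subset_of_isPreconnected_of_disjoint {K : Type*} [Field K] {B : Subgroup (PGL(2, K))}
    (hB : @IsPreconnected _ (kTopology K) (B : Set (PGL(2, K)))) {Z₁ Z₂ : Set (PGL(2, K))}
    (h₁ : IsClosed[kTopology K] Z₁) (h₂ : IsClosed[kTopology K] Z₂)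
    (h : (B : Set (PGL(2, K))) ⊆ Z₁ ∪ Z₂) (hd : Z₁ ∩ Z₂ = ∅) (h1 : 1 ∈ Z₁) :
    (B : Set (PGL(2, K))) ⊆ Z₁ := by
  let _ := kTopology K
  refine (isPreconnected_iff_subset_of_disjoint_closed.1 hB Z₁ Z₂ h₁ h₂ h
    (by rw [hd, Set.inter_empty])).resolve_right fun h' => ?_
  have : (1 : PGL(2, K)) ∈ Z₁ ∩ Z₂ := ⟨h1, h' (one_mem B)⟩
  rw [hd] at this
  exact this

/-- A connected subgroup on which one of two incompatible systems of linear equations holds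
satisfies the system that holds at the identity. -/
theorem linear_equations_of_isPreconnected {K ι : Type*} [Field K] {B : Subgroup (PGL(2, K))}
    (hB : @IsPreconnected _ (kTopology K) (B : Set (PGL(2, K))))
    (l₁ l₂ : Matrix (Fin 2) (Fin 2) K →ₗ[K] (ι → K))
    (h : ∀ N : GL (Fin 2) K, ProjGenLinGroup.mk N ∈ B → l₁ N.val = 0 ∨ l₂ N.val = 0)
    (hd : ∀ N : GL (Fin 2) K, l₁ N.val = 0 → l₂ N.val = 0 → l₁ = l₂)
    (h1 : l₁ 1 = 0) (N : GL (Fin 2) K) (hN : ProjGenLinGroup.mk N ∈ B) : l₁ N.val = 0 := by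
  -- The systems can coincide, for instance when `-M = M` in characteristic `2` or when an
  -- eigenvalue is double. If they differ, `hd` makes their zero sets disjoint.
  by_cases heq : l₁ = l₂
  · simpa [heq] using h N hN
  have scale : ∀ (l : Matrix (Fin 2) (Fin 2) K →ₗ[K] (ι → K)) (N N' : GL (Fin 2) K),
      ProjGenLinGroup.mk N' = ProjGenLinGroup.mk N → l N'.val = 0 → l N.val = 0 := by
    intro l N N' hNN' h0
    obtain ⟨c, -, hc⟩ := mk_eq_mk_iff.1 hNN'
    rw [hc, map_smul, h0, smul_zero]
  have := subset_of_isPreconnected_of_disjoint hB (isClosed_setOf_linearMap l₁)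
    (isClosed_setOf_linearMap l₂) ?_ ?_ ⟨1, rfl, h1⟩ hN
  · obtain ⟨N', h', h''⟩ := this
    exact scale l₁ N N' h' h''
  · intro x hx
    obtain ⟨N, rfl⟩ := ProjGenLinGroup.mk_surjective x
    exact (h N hx).imp (fun h => ⟨N, rfl, h⟩) fun h => ⟨N, rfl, h⟩
  · rw [Set.eq_empty_iff_forall_notMem]
    rintro _ ⟨⟨N, rfl, hN⟩, N', h', hN'⟩
    exact heq (hd N hN (scale l₂ N N' h' hN'))

/-! ### Two by two matrices -/

/-- One of `M 0 1`, `M 1 0`, `M 0 0 - M 1 1` is nonzero because `M` is not scalar. The corresponding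
quantity for `N` determines `y`, and the entries of `N * M = M * N` give the other equalities. -/
theorem exists_eq_of_commute {K : Type*} [Field K] {M N : Matrix (Fin 2) (Fin 2) K}
    (hM : ∀ c : K, M ≠ c • (1 : Matrix (Fin 2) (Fin 2) K)) (h : N * M = M * N) :
    ∃ x y : K, N = x • (1 : Matrix (Fin 2) (Fin 2) K) + y • M := by
  have h00 := congrFun₂ h 0 0
  have h01 := congrFun₂ h 0 1
  have h10 := congrFun₂ h 1 0
  simp only [Matrix.mul_apply, Fin.sum_univ_two] at h00 h01 h10
  have main : ∃ x y : K, N 0 0 = x + y * M 0 0 ∧ N 0 1 = y * M 0 1 ∧ N 1 0 = y * M 1 0 ∧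
      N 1 1 = x + y * M 1 1 := by
    by_cases hq : M 0 1 = 0
    · by_cases hr : M 1 0 = 0
      · have hps : M 0 0 - M 1 1 ≠ 0 := by
          intro h0
          apply hM (M 0 0)
          ext i j
          fin_cases i <;> fin_cases j <;> simp [hq, hr]
          linear_combination -h0
        have h1 : N 0 1 = 0 := by
          refine (mul_eq_zero.1 (?_ : N 0 1 * (M 0 0 - M 1 1) = 0)).resolve_right hps
          rw [hq] at h01
          linear_combination -h01
        have h2 : N 1 0 = 0 := by
          refine (mul_eq_zero.1 (?_ : N 1 0 * (M 0 0 - M 1 1) = 0)).resolve_right hps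
          rw [hr] at h10
          linear_combination h10
        refine ⟨N 0 0 - (N 0 0 - N 1 1) / (M 0 0 - M 1 1) * M 0 0,
          (N 0 0 - N 1 1) / (M 0 0 - M 1 1), by ring, by simp [h1, hq], by simp [h2, hr], ?_⟩
        field_simp
        ring
      · refine ⟨N 0 0 - N 1 0 / M 1 0 * M 0 0, N 1 0 / M 1 0, by ring, ?_, by field_simp, ?_⟩
        · field_simp
          linear_combination h00
        · field_simp
          linear_combination h10
    · refine ⟨N 0 0 - N 0 1 / M 0 1 * M 0 0, N 0 1 / M 0 1, by ring, by field_simp, ?_, ?_⟩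
      · field_simp
        linear_combination -h00
      · field_simp
        linear_combination -h01
  obtain ⟨x, y, h1, h2, h3, h4⟩ := main
  refine ⟨x, y, ?_⟩
  ext i j
  fin_cases i <;> fin_cases j <;> simp [h1, h2, h3, h4]

/-- A `2 × 2` matrix that is not scalar is similar to the companion matrix of its characteristic
polynomial. -/
theorem exists_mul_eq_mul_companion {K : Type*} [Field K] {M : Matrix (Fin 2) (Fin 2) K}
    (hM : ∀ c : K, M ≠ c • (1 : Matrix (Fin 2) (Fin 2) K)) :
    ∃ V : GL (Fin 2) K, M * V.val = V.val * companion M.trace (-M.det) := by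
  -- Some vector `(v, w)` is not an eigenvector; otherwise testing `(1, 0)`, `(0, 1)`, `(1, 1)`
  -- shows that `M` is scalar. In the basis formed by this vector and its image, Cayley–Hamilton
  -- gives the companion matrix.
  have main : ∃ v w : K, v * (M 1 0 * v + M 1 1 * w) - (M 0 0 * v + M 0 1 * w) * w ≠ 0 := by
    by_contra! h
    have h1 : M 1 0 = 0 := by simpa using h 1 0
    have h2 : M 0 1 = 0 := by simpa using h 0 1
    have h3 := h 1 1
    apply hM (M 0 0)
    ext i j
    fin_cases i <;> fin_cases j <;> simp [h1, h2]
    rw [h1, h2] at h3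
    linear_combination h3
  obtain ⟨v, w, h⟩ := main
  refine ⟨GeneralLinearGroup.mkOfDetNeZero
    !![v, M 0 0 * v + M 0 1 * w; w, M 1 0 * v + M 1 1 * w] ?_, ?_⟩
  · rwa [Matrix.det_fin_two_of]
  · change M * !![v, M 0 0 * v + M 0 1 * w; w, M 1 0 * v + M 1 1 * w] =
      !![v, M 0 0 * v + M 0 1 * w; w, M 1 0 * v + M 1 1 * w] * companion M.trace (-M.det)
    rw [Matrix.trace_fin_two, Matrix.det_fin_two]
    ext i j
    fin_cases i <;> fin_cases j <;> simp [companion, Matrix.mul_apply] <;> ring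

/-! ### The quadratic polynomials and the groups `G_P` -/

theorem quadPoly_eq {K : Type*} [Field K] (e f : K) :
    quadPoly e f = C 1 * X ^ 2 + C (-e) * X + C (-f) := by
  simp [quadPoly]
  ring

theorem natDegree_quadPoly {K : Type*} [Field K] (e f : K) : (quadPoly e f).natDegree = 2 := by
  rw [quadPoly_eq]
  exact natDegree_quadratic one_ne_zero

theorem monic_quadPoly {K : Type*} [Field K] (e f : K) : (quadPoly e f).Monic := by
  rw [Monic, quadPoly_eq]
  exact leadingCoeff_quadratic one_ne_zero

theorem aeval_quadPoly {K L : Type*} [Field K] [CommRing L] [Algebra K L] (e f : K) (x : L) :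
    aeval x (quadPoly e f) = x ^ 2 - algebraMap K L e * x - algebraMap K L f := by
  simp [quadPoly]

theorem irreducible_quadPoly_iff {K : Type*} [Field K] {e f : K} :
    Irreducible (quadPoly e f) ↔ ∀ x : K, x ^ 2 - e * x - f ≠ 0 := by
  have hm := monic_quadPoly e f
  rw [hm.irreducible_iff_roots_eq_zero_of_degree_le_three (natDegree_quadPoly e f).ge
    ((natDegree_quadPoly e f).le.trans (by norm_num)), Multiset.eq_zero_iff_forall_notMem]
  refine forall_congr' fun x => ?_
  rw [mem_roots hm.ne_zero, IsRoot.def, ← coe_aeval_eq_eval, aeval_quadPoly]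
  rfl

theorem det_smul_add_smul {K : Type*} [Field K] (x y : K) (M : Matrix (Fin 2) (Fin 2) K) :
    (x • (1 : Matrix (Fin 2) (Fin 2) K) + y • M).det = x ^ 2 + x * y * M.trace + y ^ 2 * M.det := by
  simp [Matrix.det_fin_two, Matrix.trace_fin_two]
  ring

theorem trace_smul_add_smul {K : Type*} [Field K] (x y : K) (M : Matrix (Fin 2) (Fin 2) K) :
    (x • (1 : Matrix (Fin 2) (Fin 2) K) + y • M).trace = 2 * x + y * M.trace := by
  simp [Matrix.trace_fin_two]
  ring

theorem mk_mem_compGroup {L : Type*} [Field L] {e f : L} {N : GL (Fin 2) L} {x y : L}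
    (h : N.val = x • (1 : Matrix (Fin 2) (Fin 2) L) + y • companion e f) :
    ProjGenLinGroup.mk N ∈ compGroup e f := by
  refine ⟨x, y, N, ?_, h, rfl⟩
  rintro ⟨⟩
  exact N.ne_zero (by rw [h, zero_smul, zero_smul, add_zero])

theorem mk_mem_compGroup_iff {L : Type*} [Field L] {e f : L} {N : GL (Fin 2) L} :
    ProjGenLinGroup.mk N ∈ compGroup e f ↔
      ∃ x y : L, N.val = x • (1 : Matrix (Fin 2) (Fin 2) L) + y • companion e f := by
  refine ⟨?_, fun ⟨x, y, h⟩ => mk_mem_compGroup h⟩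
  rintro ⟨x, y, M, -, hM, h⟩
  obtain ⟨c, -, hc⟩ := mk_eq_mk_iff.1 h
  exact ⟨c * x, c * y, by rw [hc, hM, smul_add, smul_smul, smul_smul]⟩

theorem mk_mem_affOne {K : Type*} [Field K] {N : GL (Fin 2) K} (h : N.val 1 0 = 0) :
    ProjGenLinGroup.mk N ∈ affOne K := by
  have hd := det_ne_zero_GL N
  rw [Matrix.det_fin_two, h, mul_zero, sub_zero] at hd
  have h0 := left_ne_zero_of_mul hd
  have h1 := right_ne_zero_of_mul hd
  refine ⟨N.val 0 0 / N.val 1 1, N.val 0 1 / N.val 1 1, GeneralLinearGroup.mkOfDetNeZero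
    !![N.val 0 0 / N.val 1 1, N.val 0 1 / N.val 1 1; 0, 1] ?_, rfl, ?_⟩
  · simp [h0, h1]
  · rw [mk_eq_mk_iff]
    refine ⟨N.val 1 1, h1, ?_⟩
    change _ = N.val 1 1 • !![N.val 0 0 / N.val 1 1, N.val 0 1 / N.val 1 1; 0, 1]
    ext i j
    fin_cases i <;> fin_cases j <;> simp [h] <;> field_simp

theorem isConjInto_of_forall {G : Type*} [Group G] {H H' : Subgroup G} (u : G)
    (h : ∀ b ∈ H, u * b * u⁻¹ ∈ H') : IsConjInto H H' := by
  refine ⟨_, ?_, u, rfl⟩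
  rintro _ ⟨b, hb, rfl⟩
  exact h b hb

theorem IsConjInto.exists_forall {G : Type*} [Group G] {H H' : Subgroup G}
    (h : IsConjInto H H') : ∃ u : G, ∀ b ∈ H, u * b * u⁻¹ ∈ H' := by
  obtain ⟨_, hle, u, rfl⟩ := h
  exact ⟨u, fun b hb => hle ⟨b, hb, rfl⟩⟩

/-! ### Closed connected solvable subgroups are conjugate into `Aff₁` or some `G_P` -/

/-- The linear map `N ↦ N X - Y N`. -/
def mulSubMul {K : Type*} [Field K] (X Y : Matrix (Fin 2) (Fin 2) K) :
    Matrix (Fin 2) (Fin 2) K →ₗ[K] (Fin 2 × Fin 2 → K) where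
  toFun N p := (N * X - Y * N) p.1 p.2
  map_add' N N' := by
    ext p
    simp only [add_mul, mul_add, Matrix.sub_apply, Matrix.add_apply, Pi.add_apply]
    ring
  map_smul' c N := by
    ext p
    simp [mul_sub]

theorem mulSubMul_eq_zero {K : Type*} [Field K] {X Y N : Matrix (Fin 2) (Fin 2) K} :
    mulSubMul X Y N = 0 ↔ N * X = Y * N := by
  rw [← sub_eq_zero (a := N * X)]
  constructor
  · intro h
    ext i j
    exact congrFun h (i, j)
  · intro h
    ext p
    exact congrFun₂ h p.1 p.2

/-- An invertible `N` satisfying both equations forces `X = Y`, so the alternatives are disjoint or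
identical, and the identity satisfies the first. -/
theorem commute_of_isPreconnected {K : Type*} [Field K] {B : Subgroup (PGL(2, K))}
    (hB : @IsPreconnected _ (kTopology K) (B : Set (PGL(2, K))))
    {X Y : Matrix (Fin 2) (Fin 2) K}
    (h : ∀ N : GL (Fin 2) K, ProjGenLinGroup.mk N ∈ B → N.val * X = X * N.val ∨
      N.val * X = Y * N.val)
    (N : GL (Fin 2) K) (hN : ProjGenLinGroup.mk N ∈ B) : N.val * X = X * N.val := by
  refine mulSubMul_eq_zero.1 (linear_equations_of_isPreconnected hB (mulSubMul X X)
    (mulSubMul X Y) (by simpa only [mulSubMul_eq_zero] using h) ?_ ?_ N hN)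
  · intro N h1 h2
    rw [mulSubMul_eq_zero] at h1 h2
    rw [h1] at h2
    rw [N.isUnit.mul_right_cancel h2]
  · rw [mulSubMul_eq_zero, one_mul, mul_one]

/-- The linear map `N ↦ (M - c) N v`. -/
def subSmulMulVec {K : Type*} [Field K] (M : Matrix (Fin 2) (Fin 2) K) (c : K) (v : Fin 2 → K) :
    Matrix (Fin 2) (Fin 2) K →ₗ[K] (Fin 2 → K) where
  toFun N := M *ᵥ (N *ᵥ v) - c • (N *ᵥ v)
  map_add' N N' := by
    rw [Matrix.add_mulVec, Matrix.mulVec_add, smul_add]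
    abel
  map_smul' c N := by
    rw [Matrix.smul_mulVec, Matrix.mulVec_smul, smul_comm, RingHom.id_apply, smul_sub]

theorem det_sub_smul_one {K : Type*} [Field K] (M : Matrix (Fin 2) (Fin 2) K) (c : K) :
    (M - c • (1 : Matrix (Fin 2) (Fin 2) K)).det = c ^ 2 - M.trace * c + M.det := by
  simp [Matrix.det_fin_two, Matrix.trace_fin_two]
  ring

theorem eigenvalue_sq {K : Type*} [Field K] {M : Matrix (Fin 2) (Fin 2) K} {c : K} {v : Fin 2 → K}
    (hv : v ≠ 0) (h : M *ᵥ v = c • v) : c ^ 2 - M.trace * c + M.det = 0 := by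
  rw [← det_sub_smul_one, ← Matrix.exists_mulVec_eq_zero_iff]
  exact ⟨v, hv, by rw [Matrix.sub_mulVec, Matrix.smul_mulVec, Matrix.one_mulVec, h, sub_self]⟩

/-- The hypothesis says that `B` fixes the line of `v`; in a basis starting with `v` its elements
are upper triangular. -/
theorem isConjInto_affOne_of_eigenvector {K : Type*} [Field K] {B : Subgroup (PGL(2, K))}
    {v : Fin 2 → K} (hv : v ≠ 0)
    (h : ∀ N : GL (Fin 2) K, ProjGenLinGroup.mk N ∈ B → v 0 * (N.val *ᵥ v) 1 = v 1 * (N.val *ᵥ v) 0) :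
    IsConjInto B (affOne K) := by
  have hV : ∃ V : GL (Fin 2) K, V.val 0 0 = v 0 ∧ V.val 1 0 = v 1 := by
    by_cases h0 : v 0 = 0
    · have h1 : v 1 ≠ 0 := by
        intro h1
        apply hv
        ext i
        fin_cases i <;> simp [h0, h1]
      exact ⟨GeneralLinearGroup.mkOfDetNeZero !![v 0, 1; v 1, 0] (by simpa using h1), rfl, rfl⟩
    · exact ⟨GeneralLinearGroup.mkOfDetNeZero !![v 0, 0; v 1, 1] (by simpa using h0), rfl, rfl⟩
  obtain ⟨V, hV0, hV1⟩ := hV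
  refine isConjInto_of_forall (ProjGenLinGroup.mk V⁻¹) fun b hb => ?_
  obtain ⟨N, rfl⟩ := ProjGenLinGroup.mk_surjective b
  rw [← map_inv, inv_inv, ← map_mul, ← map_mul]
  apply mk_mem_affOne
  have hN := h N hb
  simp only [Matrix.mulVec, dotProduct, Fin.sum_univ_two] at hN
  rw [Units.val_mul, Units.val_mul, Matrix.coe_units_inv, Matrix.inv_def, Matrix.adjugate_fin_two,
    Matrix.smul_mul, Matrix.smul_mul, Matrix.smul_apply]
  simp only [Matrix.mul_apply, Fin.sum_univ_two, hV0, hV1, Matrix.of_apply, Matrix.cons_val',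
    Matrix.cons_val_zero, Matrix.cons_val_one, Matrix.cons_val_fin_one]
  rw [smul_eq_mul]
  refine mul_eq_zero_of_right _ ?_
  linear_combination hN

section Classification

variable {K : Type*} [Field K] {B : Subgroup (PGL(2, K))} {M : Matrix (Fin 2) (Fin 2) K}

/-- Let `v` be a `c`-eigenvector of `M`. Since `N M N⁻¹ = x + y M` with `y ≠ 0`, `N v` is again an
eigenvector of `M`, for `c` or for `M.trace - c`. Connectedness leaves `c`, and then `N v` is
proportional to `v`, since otherwise `M` would act as `c` on a basis. -/
theorem isConjInto_affOne_of_root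
    (hB : @IsPreconnected _ (kTopology K) (B : Set (PGL(2, K))))
    (hM : ∀ c : K, M ≠ c • (1 : Matrix (Fin 2) (Fin 2) K))
    (hBM : ∀ N : GL (Fin 2) K, ProjGenLinGroup.mk N ∈ B →
      ∃ x y : K, N.val * M = (x • (1 : Matrix (Fin 2) (Fin 2) K) + y • M) * N.val)
    {c : K} (hc : c ^ 2 - M.trace * c + M.det = 0) : IsConjInto B (affOne K) := by
  obtain ⟨v, hv, hMv⟩ : ∃ v, v ≠ 0 ∧ (M - c • (1 : Matrix (Fin 2) (Fin 2) K)) *ᵥ v = 0 := by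
    rw [Matrix.exists_mulVec_eq_zero_iff, det_sub_smul_one, hc]
  rw [Matrix.sub_mulVec, Matrix.smul_mulVec, Matrix.one_mulVec, sub_eq_zero] at hMv
  have hNv : ∀ N : GL (Fin 2) K, N.val *ᵥ v ≠ 0 := fun N h => hv (by
    have := congrArg (fun w => (N⁻¹).val *ᵥ w) h
    simpa only [Matrix.mulVec_mulVec, Units.inv_mul, Matrix.one_mulVec, Matrix.mulVec_zero] using this)
  have key := linear_equations_of_isPreconnected hB (subSmulMulVec M c v)
    (subSmulMulVec M (M.trace - c) v) ?_ ?_ ?_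
  · refine isConjInto_affOne_of_eigenvector hv fun N hN => ?_
    have h := sub_eq_zero.1 (key N hN)
    generalize N.val *ᵥ v = w at h
    by_contra hne
    apply hM c
    have hW : IsUnit !![v 0, w 0; v 1, w 1] := by
      rw [Matrix.isUnit_iff_isUnit_det, Matrix.det_fin_two_of, isUnit_iff_ne_zero]
      exact fun h0 => hne (by linear_combination h0)
    refine hW.mul_right_cancel ?_
    have h1 := congrFun hMv
    have h2 := congrFun h
    simp only [Matrix.mulVec, dotProduct, Fin.sum_univ_two, Pi.smul_apply, smul_eq_mul] at h1 h2
    ext i j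
    fin_cases i <;> fin_cases j <;> simp [Matrix.mul_apply, h1, h2]
  · intro N hN
    obtain ⟨x, y, hxy⟩ := hBM N hN
    have hy : y ≠ 0 := by
      rintro rfl
      apply hM x
      rw [zero_smul, add_zero, Matrix.smul_mul, one_mul, ← mul_one (N.val), mul_assoc, one_mul,
        ← Matrix.mul_smul] at hxy
      exact N.isUnit.mul_left_cancel hxy
    have h1 : M *ᵥ (N.val *ᵥ v) = ((c - x) / y) • (N.val *ᵥ v) := by
      have := congrArg (fun X => X *ᵥ v) hxy
      simp only [← Matrix.mulVec_mulVec, hMv, Matrix.add_mulVec, Matrix.smul_mulVec,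
        Matrix.one_mulVec, Matrix.mulVec_smul] at this
      rw [← sub_eq_iff_eq_add', ← sub_smul] at this
      rw [div_eq_inv_mul, mul_smul, this, smul_smul, inv_mul_cancel₀ hy, one_smul]
    have h2 := eigenvalue_sq (hNv N) h1
    generalize (c - x) / y = μ at h1 h2
    have h3 : (μ - c) * (μ - (M.trace - c)) = 0 := by linear_combination h2 - hc
    rcases mul_eq_zero.1 h3 with h | h
    · left
      rw [sub_eq_zero.1 h] at h1
      exact sub_eq_zero.2 h1
    · right
      rw [sub_eq_zero.1 h] at h1
      exact sub_eq_zero.2 h1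
  · intro N h1 h2
    have h3 := (sub_eq_zero.1 h1).symm.trans (sub_eq_zero.1 h2)
    rw [smul_left_injective K (hNv N) h3]
    congr 2
    have := smul_left_injective K (hNv N) h3
    linear_combination this
  · change M *ᵥ (1 *ᵥ v) - c • (1 *ᵥ v) = 0
    rw [Matrix.one_mulVec, hMv, sub_self]

/-- Here `K[M]` is a quadratic field, and conjugation by `N` sends `M` to a root of its minimal
polynomial, that is to `M` or `M.trace - M`. Connectedness leaves `M`, so `N` lies in the
centraliser `K[M]`. -/
theorem isConjInto_compGroup_of_irreducible
    (hB : @IsPreconnected _ (kTopology K) (B : Set (PGL(2, K))))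
    (hM : ∀ c : K, M ≠ c • (1 : Matrix (Fin 2) (Fin 2) K))
    (hBM : ∀ N : GL (Fin 2) K, ProjGenLinGroup.mk N ∈ B →
      ∃ x y : K, N.val * M = (x • (1 : Matrix (Fin 2) (Fin 2) K) + y • M) * N.val)
    (hc : ∀ c : K, c ^ 2 - M.trace * c + M.det ≠ 0) :
    IsConjInto B (compGroup M.trace (-M.det)) := by
  have key := commute_of_isPreconnected hB (X := M)
    (Y := M.trace • (1 : Matrix (Fin 2) (Fin 2) K) - M) ?_
  · obtain ⟨V, hV⟩ := exists_mul_eq_mul_companion hM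
    refine isConjInto_of_forall (ProjGenLinGroup.mk V⁻¹) fun b hb => ?_
    obtain ⟨N, rfl⟩ := ProjGenLinGroup.mk_surjective b
    rw [← map_inv, inv_inv, ← map_mul, ← map_mul]
    obtain ⟨x, y, hN⟩ := exists_eq_of_commute hM (key N hb)
    apply mk_mem_compGroup (x := x) (y := y)
    rw [Units.val_mul, Units.val_mul, mul_assoc, hN, add_mul, Matrix.smul_mul, Matrix.smul_mul, hV,
      one_mul, mul_add, Matrix.mul_smul, Matrix.mul_smul, Units.inv_mul, Units.inv_mul_cancel_left]
  · intro N hN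
    obtain ⟨x, y, hxy⟩ := hBM N hN
    have hX : x • (1 : Matrix (Fin 2) (Fin 2) K) + y • M = N.val * M * (N⁻¹).val := by
      rw [hxy, Units.mul_inv_cancel_right]
    have htr : 2 * x + y * M.trace = M.trace := by
      rw [← trace_smul_add_smul, hX, Matrix.trace_units_conj]
    have hdet : x ^ 2 + x * y * M.trace + y ^ 2 * M.det = M.det := by
      rw [← det_smul_add_smul, hX, Matrix.det_units_conj]
    rw [hxy]
    -- With `X = x + y M`, this is the factorisation `(X - M) (X - (tr M - M)) = 0` of the
    -- characteristic equation. The first factor is zero or invertible, as the characteristic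
    -- polynomial has no root.
    have hprod : (x • (1 : Matrix (Fin 2) (Fin 2) K) + (y - 1) • M) *
        (x • (1 : Matrix (Fin 2) (Fin 2) K) + y • M -
          (M.trace • (1 : Matrix (Fin 2) (Fin 2) K) - M)) = 0 := by
      rw [Matrix.trace_fin_two] at htr hdet ⊢
      rw [Matrix.det_fin_two] at hdet
      ext i j
      fin_cases i <;> fin_cases j <;> simp [Matrix.mul_apply, Fin.sum_univ_two]
      · linear_combination (x + y * M 0 0) * htr - hdet
      · linear_combination (y * M 0 1) * htr
      · linear_combination (y * M 1 0) * htr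
      · linear_combination (x + y * M 1 1) * htr - hdet
    by_cases h0 : (x • (1 : Matrix (Fin 2) (Fin 2) K) + (y - 1) • M).det = 0
    · left
      rw [det_smul_add_smul] at h0
      have hy : y - 1 = 0 := by
        by_contra hy
        apply hc (-x / (y - 1))
        field_simp
        linear_combination h0
      have hx : x = 0 := by simpa [hy] using h0
      rw [hx, sub_eq_zero.1 hy, zero_smul, zero_add, one_smul]
    · right
      have hu : IsUnit (x • (1 : Matrix (Fin 2) (Fin 2) K) + (y - 1) • M) := by
        rwa [Matrix.isUnit_iff_isUnit_det, isUnit_iff_ne_zero]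
      rw [hu.mul_right_eq_zero, sub_eq_zero] at hprod
      rw [hprod]

theorem isConjInto_affOne_or_compGroup
    (hB : @IsPreconnected _ (kTopology K) (B : Set (PGL(2, K)))) (hs : Group.IsSolvable B) :
    IsConjInto B (affOne K) ∨
      ∃ e f : K, Irreducible (quadPoly e f) ∧ IsConjInto B (compGroup e f) := by
  by_cases hne : B = ⊥
  · left
    subst hne
    refine isConjInto_of_forall 1 fun b hb => ?_
    rw [Subgroup.mem_bot.1 hb]
    simp [one_mem]
  obtain ⟨A, hA, hAc, hcomm, hnorm⟩ := exists_connected_commutative_normal hB hs hne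
  obtain ⟨⟨a, haA⟩, ha⟩ := Subgroup.ne_bot_iff_exists_ne_one.1 hA
  rw [ne_eq, Subgroup.mk_eq_one] at ha
  obtain ⟨M, rfl⟩ := ProjGenLinGroup.mk_surjective a
  have hM : ∀ c : K, M.val ≠ c • (1 : Matrix (Fin 2) (Fin 2) K) := by
    intro c hc
    apply ha
    rw [← map_one ProjGenLinGroup.mk, eq_comm, mk_eq_mk_iff]
    refine ⟨c, ?_, hc⟩
    rintro rfl
    exact M.ne_zero (by rw [hc, zero_smul])
  -- Commuting classes have lifts that commute up to a scalar `c`; comparing determinants gives `c ^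
  -- 2 = 1`.
  have hAM := commute_of_isPreconnected hAc (X := M.val) (Y := -M.val) (by
    intro N hN
    have h := hcomm _ haA _ hN
    rw [← map_mul, ← map_mul, mk_eq_mk_iff] at h
    obtain ⟨c, hc0, hc⟩ := h
    rw [Units.val_mul, Units.val_mul] at hc
    have hd := congrArg Matrix.det hc
    rw [Matrix.det_smul, Matrix.det_mul, Matrix.det_mul, mul_comm, Fintype.card_fin] at hd
    have hMN := mul_ne_zero (det_ne_zero_GL M) (det_ne_zero_GL N)
    have h1 : c ^ 2 = 1 := mul_right_cancel₀ hMN (by rw [← hd, one_mul])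
    rcases sq_eq_one_iff.1 h1 with rfl | rfl
    · left; rw [hc, one_smul]
    · right; rw [hc, neg_smul, one_smul, neg_mul])
  have hBM : ∀ N : GL (Fin 2) K, ProjGenLinGroup.mk N ∈ B →
      ∃ x y : K, N.val * M.val = (x • (1 : Matrix (Fin 2) (Fin 2) K) + y • M.val) * N.val := by
    intro N hN
    have h := hnorm _ hN _ haA
    rw [← map_inv, ← map_mul, ← map_mul] at h
    obtain ⟨x, y, hxy⟩ := exists_eq_of_commute hM (hAM _ h)
    refine ⟨x, y, ?_⟩
    rw [← hxy, Units.val_mul, Units.inv_mul_cancel_right, Units.val_mul]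
  by_cases hroot : ∃ c : K, c ^ 2 - M.val.trace * c + M.val.det = 0
  · obtain ⟨c, hc⟩ := hroot
    exact Or.inl (isConjInto_affOne_of_root hB hM hBM hc)
  · push Not at hroot
    refine Or.inr ⟨_, _, irreducible_quadPoly_iff.2 fun x => ?_,
      isConjInto_compGroup_of_irreducible hB hM hBM hroot⟩
    rw [sub_neg_eq_add]
    exact hroot x

end Classification

/-! ### Quadratic extensions -/

theorem finrank_adjoinRoot_quadPoly {K : Type*} [Field K] (e f : K) :
    Module.finrank K (AdjoinRoot (quadPoly e f)) = 2 := by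
  rw [(AdjoinRoot.powerBasis (monic_quadPoly e f).ne_zero).finrank,
    AdjoinRoot.powerBasis_dim, natDegree_quadPoly]

theorem nonempty_algEquiv_of_root {K L : Type*} [Field K] [Field L] [Algebra K L]
    (hL : Module.finrank K L = 2) {e f : K} (h : Irreducible (quadPoly e f)) {x : L}
    (hx : x ^ 2 - algebraMap K L e * x - algebraMap K L f = 0) :
    Nonempty (AdjoinRoot (quadPoly e f) ≃ₐ[K] L) := by
  have := Fact.mk h
  have hx' : aeval x (quadPoly e f) = 0 := by rw [aeval_quadPoly, hx]
  let φ : AdjoinRoot (quadPoly e f) →ₐ[K] L := AdjoinRoot.liftAlgHom _ (Algebra.ofId K L) x hx'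
  have hinj : Function.Injective φ := φ.toRingHom.injective
  have := Module.finite_of_finrank_eq_succ hL
  have := Module.finite_of_finrank_eq_succ (finrank_adjoinRoot_quadPoly e f)
  refine ⟨AlgEquiv.ofBijective φ ⟨hinj, ?_⟩⟩
  exact (LinearMap.injective_iff_surjective_of_finrank_eq_finrank (f := φ.toLinearMap)
    ((finrank_adjoinRoot_quadPoly e f).trans hL.symm)).1 hinj

section FinrankTwo

variable {K L : Type*} [Field K] [Field L] [Algebra K L]

theorem eq_zero_of_add_mul_eq_zero {x : L} (hx : x ∉ Set.range (algebraMap K L)) {a b : K}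
    (h : algebraMap K L a + algebraMap K L b * x = 0) : a = 0 ∧ b = 0 := by
  have hb : b = 0 := by
    by_contra hb
    refine hx ⟨-a / b, ?_⟩
    have : algebraMap K L b ≠ 0 := by simpa using hb
    rw [map_div₀, map_neg]
    field_simp
    linear_combination -h
  subst hb
  simpa using h

theorem exists_eq_add_mul (hL : Module.finrank K L = 2) {x : L}
    (hx : x ∉ Set.range (algebraMap K L)) (z : L) :
    ∃ a b : K, z = algebraMap K L a + algebraMap K L b * x := by
  have := Module.finite_of_finrank_eq_succ hL
  have hli : LinearIndependent K ![(1 : L), x] := by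
    rw [LinearIndependent.pair_iff]
    intro s t h
    rw [Algebra.smul_def, Algebra.smul_def, mul_one] at h
    exact eq_zero_of_add_mul_eq_zero hx h
  have hspan := hli.span_eq_top_of_card_eq_finrank' (by simp [hL])
  have hz : z ∈ Submodule.span K (Set.range ![(1 : L), x]) := hspan ▸ Submodule.mem_top
  rw [Matrix.range_cons, Matrix.range_cons, Matrix.range_empty, Set.union_empty,
    Set.singleton_union, Submodule.mem_span_pair] at hz
  obtain ⟨a, b, h⟩ := hz
  exact ⟨a, b, by rw [← h, Algebra.smul_def, Algebra.smul_def, mul_one]⟩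

theorem exists_irreducible_quadPoly_algEquiv (hL : Module.finrank K L = 2) :
    ∃ e f : K, Irreducible (quadPoly e f) ∧ Nonempty (AdjoinRoot (quadPoly e f) ≃ₐ[K] L) := by
  obtain ⟨x, hx⟩ : ∃ x : L, x ∉ Set.range (algebraMap K L) := by
    by_contra! h
    have hsurj : Function.Surjective (Algebra.linearMap K L) := h
    have := Module.finite_of_finrank_eq_succ hL
    have h1 := LinearMap.finrank_le_finrank_of_surjective hsurj
    rw [hL, Module.finrank_self] at h1
    omega
  obtain ⟨f, e, h⟩ := exists_eq_add_mul hL hx (x ^ 2)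
  have hirr : Irreducible (quadPoly e f) := by
    rw [irreducible_quadPoly_iff]
    intro c hc
    have hc' : algebraMap K L c ^ 2 - algebraMap K L e * algebraMap K L c - algebraMap K L f = 0 := by
      rw [← map_pow, ← map_mul, ← map_sub, ← map_sub, hc, map_zero]
    have hprod : (x - algebraMap K L c) * (x - algebraMap K L (e - c)) = 0 := by
      rw [map_sub]
      linear_combination h - hc'
    rcases mul_eq_zero.1 hprod with h0 | h0
    · exact hx ⟨_, (sub_eq_zero.1 h0).symm⟩
    · exact hx ⟨_, (sub_eq_zero.1 h0).symm⟩
  exact ⟨e, f, hirr, nonempty_algEquiv_of_root hL hirr (by rw [h]; ring)⟩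

end FinrankTwo

/-! ### Conjugacy of the groups `G_P` -/

theorem trace_companion {L : Type*} [Field L] (e f : L) : (companion e f).trace = e := by
  simp [companion, Matrix.trace_fin_two]

theorem det_companion {L : Type*} [Field L] (e f : L) : (companion e f).det = -f := by
  simp [companion, Matrix.det_fin_two]

theorem companion_ne_smul_one {L : Type*} [Field L] (e f c : L) :
    companion e f ≠ c • (1 : Matrix (Fin 2) (Fin 2) L) := by
  intro h
  simpa [companion] using congrFun₂ h 1 0

theorem mk_conj_mem_compGroup {L : Type*} [Field L] {e f e' f' x y : L} {V : GL (Fin 2) L}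
    (hV : V.val * companion e f =
      (x • (1 : Matrix (Fin 2) (Fin 2) L) + y • companion e' f') * V.val) {g : PGL(2, L)}
    (hg : g ∈ compGroup e f) :
    ProjGenLinGroup.mk V * g * (ProjGenLinGroup.mk V)⁻¹ ∈ compGroup e' f' := by
  obtain ⟨N, rfl⟩ := ProjGenLinGroup.mk_surjective g
  obtain ⟨a, b, hN⟩ := mk_mem_compGroup_iff.1 hg
  rw [← map_inv, ← map_mul, ← map_mul]
  apply mk_mem_compGroup (x := a + b * x) (y := b * y)
  rw [Units.val_mul, Units.val_mul, hN, mul_add, Matrix.mul_smul, Matrix.mul_smul, hV, mul_one,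
    add_mul, Matrix.smul_mul, Matrix.smul_mul, Units.mul_inv, Units.mul_inv_cancel_right, smul_add,
    smul_smul, smul_smul, add_smul, add_assoc]

theorem map_conj_compGroup {L : Type*} [Field L] {e f e' f' x y : L} (hy : y ≠ 0)
    {V : GL (Fin 2) L} (hV : V.val * companion e f =
      (x • (1 : Matrix (Fin 2) (Fin 2) L) + y • companion e' f') * V.val) :
    (compGroup e f).map (MulAut.conj (ProjGenLinGroup.mk V)).toMonoidHom = compGroup e' f' := by
  have hV' : (V⁻¹).val * companion e' f' =
      ((-(x / y)) • (1 : Matrix (Fin 2) (Fin 2) L) + y⁻¹ • companion e f) * (V⁻¹).val := by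
    have h1 : companion e' f' =
        (-(x / y)) • (1 : Matrix (Fin 2) (Fin 2) L) + y⁻¹ • (V.val * companion e f * (V⁻¹).val) := by
      rw [hV, Units.mul_inv_cancel_right, smul_add, smul_smul, smul_smul, inv_mul_cancel₀ hy,
        one_smul, ← add_assoc, ← add_smul, div_eq_inv_mul, neg_add_cancel, zero_smul, zero_add]
    rw [h1, mul_add, add_mul, Matrix.mul_smul, Matrix.mul_smul, Matrix.smul_mul, Matrix.smul_mul,
      mul_one, one_mul, mul_assoc V.val, Units.inv_mul_cancel_left]
  apply le_antisymm
  · rintro _ ⟨g, hg, rfl⟩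
    exact mk_conj_mem_compGroup hV hg
  · intro g hg
    refine ⟨_, mk_conj_mem_compGroup hV' hg, ?_⟩
    simp [mul_assoc]

theorem irreducible_quadPoly_ne_zero {K : Type*} [Field K] {e f : K}
    (h : Irreducible (quadPoly e f)) : f ≠ 0 := by
  rintro rfl
  exact irreducible_quadPoly_iff.1 h 0 (by simp)

/-- The companion matrix as an element of `GL₂`. -/
noncomputable def companionGL {L : Type*} [Field L] (e : L) {f : L} (hf : f ≠ 0) :
    GL (Fin 2) L :=
  GeneralLinearGroup.mkOfDetNeZero (companion e f) (by rwa [det_companion, neg_ne_zero])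

theorem coe_companionGL {L : Type*} [Field L] (e : L) {f : L} (hf : f ≠ 0) :
    (companionGL e hf).val = companion e f := rfl

theorem mk_companionGL_mem {L : Type*} [Field L] (e : L) {f : L} (hf : f ≠ 0) :
    ProjGenLinGroup.mk (companionGL e hf) ∈ compGroup e f :=
  mk_mem_compGroup (x := 0) (y := 1) (by rw [coe_companionGL, zero_smul, zero_add, one_smul])

/-- The class of `C_P` lies in `G_P`, so its conjugate has the form `x + y C_Q`; `y = 0` would make
`C_P` scalar. -/
theorem AreConj.exists_mul_companion_eq {L : Type*} [Field L] {e f e' f' : L} (hf : f ≠ 0)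
    (h : AreConj (compGroup e f) (compGroup e' f')) :
    ∃ (V : GL (Fin 2) L) (x y : L), y ≠ 0 ∧ V.val * companion e f =
      (x • (1 : Matrix (Fin 2) (Fin 2) L) + y • companion e' f') * V.val := by
  obtain ⟨u, hu⟩ := h
  obtain ⟨V, rfl⟩ := ProjGenLinGroup.mk_surjective u
  have h1 : ProjGenLinGroup.mk (V * companionGL e hf * V⁻¹) ∈ compGroup e' f' := by
    rw [← hu]
    exact ⟨_, mk_companionGL_mem e hf, by simp⟩
  obtain ⟨x, y, hxy⟩ := mk_mem_compGroup_iff.1 h1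
  have h2 : V.val * companion e f =
      (x • (1 : Matrix (Fin 2) (Fin 2) L) + y • companion e' f') * V.val := by
    rw [← hxy, Units.val_mul, Units.inv_mul_cancel_right, Units.val_mul, coe_companionGL]
  refine ⟨V, x, y, ?_, h2⟩
  rintro rfl
  apply companion_ne_smul_one e f x
  refine V.isUnit.mul_left_cancel ?_
  rw [h2, zero_smul, add_zero, Matrix.smul_mul, one_mul, Matrix.mul_smul, mul_one]

theorem areKIsomorphic_of_map_conj {K : Type*} [Field K]
    {H H' : Subgroup (PGL(2, AlgebraicClosure K))} (U : GL (Fin 2) K)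
    (h : H.map (MulAut.conj (ProjGenLinGroup.mk (baseChange _ U))).toMonoidHom = H') :
    AreKIsomorphic K H H' := by
  subst h
  set u := ProjGenLinGroup.mk (baseChange (AlgebraicClosure K) U)
  have hinv : ProjGenLinGroup.mk (baseChange (AlgebraicClosure K) U⁻¹) = u⁻¹ :=
    (congrArg ProjGenLinGroup.mk (map_inv (GeneralLinearGroup.map _) U)).trans (map_inv _ _)
  refine ⟨H.equivMapOfInjective _ (MulAut.conj u).injective, ?_, ?_⟩
  · rintro φ ⟨h, hh, hφ⟩
    refine ⟨_, hh.comp_mul U U⁻¹, fun x => (hφ _).trans (congrArg h ?_)⟩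
    rw [hinv]
    rfl
  · rintro φ ⟨h, hh, hφ⟩
    refine ⟨_, hh.comp_mul U⁻¹ U, fun x => (hφ _).trans (congrArg h ?_)⟩
    obtain ⟨x, rfl⟩ := (H.equivMapOfInjective _ (MulAut.conj u).injective).surjective x
    rw [MulEquiv.symm_apply_apply, hinv]
    change x.1 = u⁻¹ * (u * x * u⁻¹) * u
    group

theorem areKIsomorphic_of_areConj {K : Type*} [Field K] {e f e' f' : K} (hf : f ≠ 0)
    (h : AreConj (compGroup e f) (compGroup e' f')) :
    AreKIsomorphic K (compAlgGroup e f) (compAlgGroup e' f') := by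
  obtain ⟨V, x, y, hy, hV⟩ := h.exists_mul_companion_eq hf
  refine areKIsomorphic_of_map_conj V (map_conj_compGroup
    (x := algebraMap K _ x) (y := algebraMap K _ y) (by simpa using hy) ?_)
  have hc : ∀ a b : K, companion (algebraMap K (AlgebraicClosure K) a) (algebraMap K _ b) =
      (companion a b).map (algebraMap K (AlgebraicClosure K)) := by
    intro a b
    ext i j
    fin_cases i <;> fin_cases j <;> simp [companion]
  have := congrArg (fun M => M.map (algebraMap K (AlgebraicClosure K))) hV
  simp only [Matrix.map_mul] at this
  rw [coe_baseChange, hc, hc, this]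
  congr 1
  ext i j
  simp only [Matrix.map_apply, Matrix.add_apply, Matrix.smul_apply, smul_eq_mul, map_add, map_mul]
  fin_cases i <;> fin_cases j <;> simp

/-- A root `x + yα` of `Q` in `K[T]/P` corresponds to `N = xI + yC_P`. The coefficients of `Q(x +
yα) = 0` in the basis `1, α` give the trace and determinant of `N`, so `N` is similar to `C_Q`. As
`y ≠ 0`, `N` and `C_P` span the same plane with `I`. -/
theorem areConj_of_algEquiv {K : Type*} [Field K] {e f e' f' : K}
    (hP : Irreducible (quadPoly e f)) (hQ : Irreducible (quadPoly e' f'))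
    (h : Nonempty (AdjoinRoot (quadPoly e f) ≃ₐ[K] AdjoinRoot (quadPoly e' f'))) :
    AreConj (compGroup e f) (compGroup e' f') := by
  obtain ⟨σ⟩ := h
  have := Fact.mk hP
  have := Fact.mk hQ
  have hroot : ∀ a b : K, AdjoinRoot.root (quadPoly a b) ^ 2 - algebraMap K _ a * AdjoinRoot.root (quadPoly a b) -
        algebraMap K _ b = 0 := by
    intro a b
    rw [← aeval_quadPoly, AdjoinRoot.aeval_eq, AdjoinRoot.mk_self]
  set α := AdjoinRoot.root (quadPoly e f) with hα
  have hα2 := hroot e f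
  rw [← hα] at hα2
  have hαK : α ∉ Set.range (algebraMap K (AdjoinRoot (quadPoly e f))) := by
    rintro ⟨c, hc⟩
    apply irreducible_quadPoly_iff.1 hP c
    apply (algebraMap K (AdjoinRoot (quadPoly e f))).injective
    rw [map_zero, map_sub, map_sub, map_pow, map_mul, hc, hα2]
  obtain ⟨z, hz⟩ : ∃ z : AdjoinRoot (quadPoly e f),
      z ^ 2 - algebraMap K _ e' * z - algebraMap K _ f' = 0 := by
    refine ⟨σ.symm (AdjoinRoot.root _), ?_⟩
    have := congrArg σ.symm (hroot e' f')
    simpa only [map_sub, map_mul, map_pow, map_zero, AlgEquiv.commutes] using this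
  obtain ⟨x, y, rfl⟩ := exists_eq_add_mul (finrank_adjoinRoot_quadPoly e f) hαK z
  obtain ⟨h1, h2⟩ := eq_zero_of_add_mul_eq_zero (K := K) hαK
    (a := x ^ 2 + y ^ 2 * f - e' * x - f') (b := 2 * x * y + y ^ 2 * e - e' * y) (by
      simp only [map_sub, map_add, map_mul, map_pow, map_ofNat]
      linear_combination hz - algebraMap K _ y ^ 2 * hα2)
  have hy : y ≠ 0 := by
    rintro rfl
    exact irreducible_quadPoly_iff.1 hQ x (by linear_combination h1)
  have h3 : 2 * x + y * e = e' := by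
    apply mul_left_cancel₀ hy
    linear_combination h2
  set N := x • (1 : Matrix (Fin 2) (Fin 2) K) + y • companion e f with hN
  have htr : N.trace = e' := by rw [hN, trace_smul_add_smul, trace_companion, h3]
  have hdet : -N.det = f' := by
    rw [hN, det_smul_add_smul, trace_companion, det_companion]
    linear_combination -x * h3 + h1
  obtain ⟨V, hV⟩ := exists_mul_eq_mul_companion (M := N) (by
    intro c hc
    have := congrFun₂ hc 1 0
    simp [hN, companion, hy] at this)
  rw [htr, hdet] at hV
  exact (AreConj.equivalence _).symm ⟨_, map_conj_compGroup hy hV.symm⟩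

/-! ### `K`-isomorphic groups `G_P` have isomorphic quadratic extensions -/

/-- The points at infinity of the conic `uw = v²`, `u + ev - fw = 1` are `(z² : -z : 1)` with `z` a
root of `T² - eT - f`. -/
theorem exists_root_of_conic {F : Type*} [Field F] {e f u v w : F} (h : u * w = v ^ 2)
    (h' : u + e * v - f * w = 0) (hne : ¬ (u = 0 ∧ w = 0)) :
    ∃ z : F, z ^ 2 - e * z - f = 0 := by
  by_cases hw : w = 0
  · subst hw
    have hv : v = 0 := by simpa using h.symm
    subst hv
    exact absurd ⟨by simpa using h', rfl⟩ hne
  · refine ⟨-v / w, ?_⟩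
    field_simp
    linear_combination w * h' - h

/-- The coefficients in the top common degree `D > 0` would form a point at infinity over `K`, hence
a root of `Q` in `K`. -/
theorem natDegree_eq_zero_of_conic {K : Type*} [Field K] {e f : K}
    (hQ : Irreducible (quadPoly e f)) {U V W : K[X]} (h : U * W = V ^ 2)
    (h' : U + C e * V - C f * W = 1) :
    U.natDegree = 0 ∧ V.natDegree = 0 ∧ W.natDegree = 0 := by
  by_contra hcon
  set D := max (max U.natDegree W.natDegree) V.natDegree with hD
  have hU : U.natDegree ≤ D := by omega
  have hV : V.natDegree ≤ D := by omega
  have hW : W.natDegree ≤ D := by omega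
  have hpos : D ≠ 0 := by omega
  have h1 : U.coeff D * W.coeff D = V.coeff D ^ 2 := by
    rw [← coeff_mul_add_eq_of_natDegree_le hU hW, h, pow_two, pow_two,
      coeff_mul_add_eq_of_natDegree_le hV hV]
  have h2 : U.coeff D + e * V.coeff D - f * W.coeff D = 0 := by
    have := congrArg (fun p => p.coeff D) h'
    simpa [coeff_one, hpos] using this
  by_cases hne : U.coeff D = 0 ∧ W.coeff D = 0
  · have hV0 : V.coeff D = 0 := by simpa [hne.1] using h1.symm
    have key : ∀ p : K[X], p.coeff D = 0 → p.natDegree ≠ D := by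
      intro p hp hpD
      rw [← hpD] at hp
      have : p = 0 := by simpa using hp
      rw [this, natDegree_zero] at hpD
      exact hpos hpD.symm
    have := key U hne.1
    have := key V hV0
    have := key W hne.2
    omega
  · obtain ⟨z, hz⟩ := exists_root_of_conic h1 h2 hne
    exact irreducible_quadPoly_iff.1 hQ z hz

/-- Modulo `n`, the triple is a point at infinity over `K[T]/n`, giving a root, unless `n` divides
`U` and `W`. In that case `n` divides `V` too; cancelling it lowers `m`, and `m = 0` is the
polynomial case. -/
theorem exists_root_or_const_of_conic {K : Type*} [Field K] {e f : K}
    (hQ : Irreducible (quadPoly e f)) {n : K[X]} (hn : Irreducible n) (m : ℕ) {U V W : K[X]}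
    (h : U * W = V ^ 2) (h' : U + C e * V - C f * W = n ^ m) :
    (∃ z : AdjoinRoot n, z ^ 2 - algebraMap K _ e * z - algebraMap K _ f = 0) ∨
      ∃ a b c : K, U = C a * n ^ m ∧ V = C b * n ^ m ∧ W = C c * n ^ m := by
  induction m generalizing U V W with
  | zero =>
    obtain ⟨h1, h2, h3⟩ := natDegree_eq_zero_of_conic hQ h (by simpa using h')
    exact Or.inr ⟨U.coeff 0, V.coeff 0, W.coeff 0, by
      simp only [pow_zero, mul_one]
      exact ⟨eq_C_of_natDegree_eq_zero h1, eq_C_of_natDegree_eq_zero h2,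
        eq_C_of_natDegree_eq_zero h3⟩⟩
  | succ m ih =>
    by_cases hdvd : n ∣ U ∧ n ∣ W
    · obtain ⟨⟨U', rfl⟩, W', rfl⟩ := hdvd
      obtain ⟨V', rfl⟩ : n ∣ V := hn.prime.dvd_of_dvd_pow (n := 2) ⟨U' * (n * W'), by rw [← h]; ring⟩
      have hn0 := hn.ne_zero
      rcases ih (U := U') (V := V') (W := W')
        (mul_left_cancel₀ (pow_ne_zero 2 hn0) (by linear_combination h))
        (mul_left_cancel₀ hn0 (by linear_combination h')) with hz | ⟨a, b, c, rfl, rfl, rfl⟩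
      · exact Or.inl hz
      · exact Or.inr ⟨a, b, c, by ring, by ring, by ring⟩
    · left
      have := Fact.mk hn
      refine exists_root_of_conic (u := AdjoinRoot.mk n U) (v := AdjoinRoot.mk n V)
        (w := AdjoinRoot.mk n W) (by rw [← map_mul, h, map_pow]) ?_ ?_
      · have := congrArg (AdjoinRoot.mk n) h'
        simpa using this
      · rwa [AdjoinRoot.mk_eq_zero, AdjoinRoot.mk_eq_zero]

/-! ### Pulling the conic back along `t ↦ tI + C_P`. -/

section PullBack

variable {K : Type*} [Field K]

/-- The invertible matrix `t I + C_P`. -/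
noncomputable def shiftGL {L : Type*} [Field L] (e f t : L) (ht : t ^ 2 + e * t - f ≠ 0) :
    GL (Fin 2) L :=
  GeneralLinearGroup.mkOfDetNeZero (t • (1 : Matrix (Fin 2) (Fin 2) L) + companion e f) (by
    rw [← one_smul L (companion e f), det_smul_add_smul, trace_companion, det_companion]
    convert ht using 1
    ring)

theorem coe_shiftGL {L : Type*} [Field L] (e f t : L) (ht : t ^ 2 + e * t - f ≠ 0) :
    (shiftGL e f t ht).val = !![t, f; 1, t + e] := by
  have := smul_one_add_smul_companion e f t 1
  rw [one_smul, one_mul, one_mul] at this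
  exact this

theorem mk_shiftGL_mem {L : Type*} [Field L] (e f t : L) (ht : t ^ 2 + e * t - f ≠ 0) :
    ProjGenLinGroup.mk (shiftGL e f t ht) ∈ compGroup e f :=
  mk_mem_compGroup (x := t) (y := 1) (by rw [one_smul]; rfl)

/-- A regular function, restricted to the classes of `t I + C_P`, is a polynomial in `t` divided by
a power of `det (t I + C_P)`. -/
theorem IsRegular.exists_polynomial {L : Type*} [Field L] [Algebra K L] (e f : K)
    {h : PGL(2, L) → L} (hh : IsRegular K h) :
    ∃ m₀ : ℕ, ∀ m ≥ m₀, ∃ U : K[X], ∀ (t : L)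
      (ht : t ^ 2 + algebraMap K L e * t - algebraMap K L f ≠ 0),
      h (ProjGenLinGroup.mk (shiftGL (algebraMap K L e) (algebraMap K L f) t ht)) *
        (t ^ 2 + algebraMap K L e * t - algebraMap K L f) ^ m = aeval t U := by
  obtain ⟨m₀, F, hF, hh⟩ := hh
  refine ⟨m₀, fun m hm => ?_⟩
  let Q : Matrix (Fin 2) (Fin 2) K[X] := !![X, C f; 1, X + C e]
  -- `quadPoly (-e) f` at `t` is `det (tI + C_P)`. The extra power lets several functions share one
  -- denominator.
  refine ⟨MvPolynomial.aeval (fun p => Q p.1 p.2) F * (quadPoly (-e) f) ^ (m - m₀),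
    fun t ht => ?_⟩
  have hQ : (fun p : Fin 2 × Fin 2 =>
      (shiftGL (algebraMap K L e) (algebraMap K L f) t ht).val p.1 p.2) =
        fun p => aeval t (Q p.1 p.2) := by
    rw [coe_shiftGL]
    funext ⟨i, j⟩
    fin_cases i <;> fin_cases j <;> simp [Q]
  have hdet : (shiftGL (algebraMap K L e) (algebraMap K L f) t ht).val.det =
      t ^ 2 + algebraMap K L e * t - algebraMap K L f := by
    rw [coe_shiftGL, Matrix.det_fin_two_of]
    ring
  rw [hh, evalFrac, hQ, hdet, map_mul, map_pow, aeval_quadPoly, map_neg, neg_mul, sub_neg_eq_add]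
  have hF' : aeval t (MvPolynomial.aeval (fun p => Q p.1 p.2) F) =
      MvPolynomial.aeval (fun p : Fin 2 × Fin 2 => aeval t (Q p.1 p.2)) F := by
    rw [← AlgHom.comp_apply, MvPolynomial.comp_aeval]
  rw [hF', div_mul_eq_mul_div, div_eq_iff (pow_ne_zero _ ht), mul_assoc, ← pow_add,
    Nat.sub_add_cancel hm]

theorem eq_of_aeval_eq_of_ne {L : Type*} [Field L] [Algebra K L] [Infinite L] {p q n : K[X]}
    (hn : n ≠ 0) (h : ∀ t : L, aeval t n ≠ 0 → aeval t p = aeval t q) : p = q := by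
  have h0 : (p - q) * n = 0 := by
    apply map_injective (algebraMap K L) (algebraMap K L).injective
    refine Polynomial.funext fun t => ?_
    rw [Polynomial.map_zero, eval_zero, eval_map_algebraMap, map_mul, map_sub]
    by_cases ht : aeval t n = 0
    · rw [ht, mul_zero]
    · rw [h t ht, sub_self, zero_mul]
  exact sub_eq_zero.1 ((mul_eq_zero.1 h0).resolve_right hn)

/-- The functions `a² / N`, `a b / N`, `b² / N` on the group `G_P`. -/
theorem exists_conic_coordinates {L : Type*} [Field L] [Algebra K L] (e f : L) :
    ∃ u v w : PGL(2, L) → L, IsRegular K u ∧ IsRegular K v ∧ IsRegular K w ∧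
      (∀ x ∈ compGroup e f, u x * w x = v x ^ 2 ∧ u x + e * v x - f * w x = 1) ∧
      ∀ x ∈ compGroup e f, ∀ y ∈ compGroup e f, u x = u y → v x = v y → w x = w y → x = y := by
  have hX : ∀ p q : Fin 2 × Fin 2,
      (MvPolynomial.X p * MvPolynomial.X q : MvPolynomial (Fin 2 × Fin 2) K).IsHomogeneous (2 * 1) :=
    fun p q => (MvPolynomial.isHomogeneous_X K p).mul (MvPolynomial.isHomogeneous_X K q)
  obtain ⟨u, hu, hu'⟩ := exists_isRegular (L := L) 1 (hX (0, 0) (0, 0))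
  obtain ⟨v, hv, hv'⟩ := exists_isRegular (L := L) 1 (hX (0, 0) (1, 0))
  obtain ⟨w, hw, hw'⟩ := exists_isRegular (L := L) 1 (hX (1, 0) (1, 0))
  simp only [evalFrac, map_mul, MvPolynomial.aeval_X, pow_one] at hu' hv' hw'
  refine ⟨u, v, w, hu, hv, hw, ?_, ?_⟩
  · rintro x hx
    obtain ⟨N, rfl⟩ := ProjGenLinGroup.mk_surjective x
    obtain ⟨a, b, hN⟩ := mk_mem_compGroup_iff.1 hx
    have hd := det_ne_zero_GL N
    rw [hu', hv', hw']
    rw [smul_one_add_smul_companion] at hN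
    rw [hN, Matrix.det_fin_two_of] at hd ⊢
    simp only [Matrix.of_apply, Matrix.cons_val', Matrix.cons_val_zero, Matrix.cons_val_one,
      Matrix.cons_val_fin_one]
    constructor
    · field_simp
    · rw [← mul_div_assoc, ← mul_div_assoc, ← add_div, ← sub_div, div_eq_one_iff_eq hd]
      ring
  · rintro x hx y hy
    obtain ⟨N, rfl⟩ := ProjGenLinGroup.mk_surjective x
    obtain ⟨M, rfl⟩ := ProjGenLinGroup.mk_surjective y
    obtain ⟨a, b, hN⟩ := mk_mem_compGroup_iff.1 hx
    obtain ⟨c, d, hM⟩ := mk_mem_compGroup_iff.1 hy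
    have hd := det_ne_zero_GL N
    have hd' := det_ne_zero_GL M
    rw [hu', hu', hv', hv', hw', hw']
    rw [smul_one_add_smul_companion] at hN hM
    generalize N.val.det = r at *
    generalize M.val.det = s at *
    simp only [hN, hM, Matrix.of_apply, Matrix.cons_val', Matrix.cons_val_zero,
      Matrix.cons_val_one, Matrix.cons_val_fin_one]
    intro h1 h2 h3
    rw [div_eq_div_iff hd hd'] at h1 h2 h3
    rw [mk_eq_mk_iff, hN, hM]
    -- The ratio `b : a` is `v : u`; when `a = 0` both classes are that of the companion matrix.
    by_cases ha : a = 0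
    · subst ha
      have hc : c = 0 := by simpa [hd] using h1.symm
      subst hc
      have hb : b ≠ 0 := by
        rintro rfl
        exact N.ne_zero (by rw [hN]; ext i j; fin_cases i <;> fin_cases j <;> simp)
      have hd0 : d ≠ 0 := by
        rintro rfl
        exact M.ne_zero (by rw [hM]; ext i j; fin_cases i <;> fin_cases j <;> simp)
      refine ⟨d / b, div_ne_zero hd0 hb, ?_⟩
      ext i j
      fin_cases i <;> fin_cases j <;> simp <;> field_simp
    · have hc : c ≠ 0 := by
        rintro rfl
        simp [ha, hd'] at h1
      have hd1 : a * d = b * c := by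
        have : a * c * r * (a * d) = a * c * r * (b * c) := by
          linear_combination -a ^ 2 * h2 + a * b * h1
        exact mul_left_cancel₀ (mul_ne_zero (mul_ne_zero ha hc) hd) this
      refine ⟨c / a, div_ne_zero hc ha, ?_⟩
      ext i j
      fin_cases i <;> fin_cases j <;> simp <;> field_simp
      · linear_combination f * hd1
      · linear_combination hd1
      · linear_combination e * hd1

/-- Composed with `ψ`, the conic coordinates of `G_Q` become fractions `U/n^m`, `V/n^m`, `W/n^m`
along `t ↦ tI + C_P`, with `n = T² + eT - f`. By `exists_root_or_const_of_conic`, either `Q` has a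
root in `K[T]/n` or the coordinates are constant, contradicting injectivity. -/
theorem nonempty_algEquiv_of_areKIsomorphic {e f e' f' : K}
    (hP : Irreducible (quadPoly e f)) (hQ : Irreducible (quadPoly e' f'))
    (h : AreKIsomorphic K (compAlgGroup e f) (compAlgGroup e' f')) :
    Nonempty (AdjoinRoot (quadPoly e f) ≃ₐ[K] AdjoinRoot (quadPoly e' f')) := by
  unfold compAlgGroup at h
  obtain ⟨ψ, hψ, -⟩ := h
  -- This polynomial is `P(-T)`, so it defines the same quadratic extension as `P`.
  have hn : Irreducible (quadPoly (-e) f) := by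
    rw [irreducible_quadPoly_iff] at hP ⊢
    intro x hx
    exact hP (-x) (by linear_combination hx)
  have := Fact.mk hn
  have hevn : ∀ t : AlgebraicClosure K, aeval t (quadPoly (-e) f) =
      t ^ 2 + algebraMap K _ e * t - algebraMap K _ f := by
    intro t
    rw [aeval_quadPoly, map_neg, neg_mul, sub_neg_eq_add]
  obtain ⟨u, v, w, hu, hv, hw, hconic, hinj⟩ := exists_conic_coordinates (K := K)
    (algebraMap K (AlgebraicClosure K) e') (algebraMap K (AlgebraicClosure K) f')
  have hpull : ∀ g : PGL(2, AlgebraicClosure K) → AlgebraicClosure K, IsRegular K g →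
      ∃ m₀ : ℕ, ∀ m ≥ m₀, ∃ U : K[X], ∀ (t : AlgebraicClosure K) (ht : _ ≠ 0),
        g (ψ ⟨_, mk_shiftGL_mem _ _ t ht⟩) * (aeval t (quadPoly (-e) f)) ^ m = aeval t U := by
    intro g hg
    obtain ⟨g', hg', h⟩ := hψ (fun x => g x) ⟨g, hg, fun _ => rfl⟩
    obtain ⟨m₀, hm₀⟩ := hg'.exists_polynomial e f
    refine ⟨m₀, fun m hm => ?_⟩
    obtain ⟨U, hU⟩ := hm₀ m hm
    refine ⟨U, fun t ht => ?_⟩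
    rw [hevn, ← hU t ht]
    exact congrArg (· * _) (h ⟨_, mk_shiftGL_mem _ _ t ht⟩)
  obtain ⟨m₁, h₁⟩ := hpull u hu
  obtain ⟨m₂, h₂⟩ := hpull v hv
  obtain ⟨m₃, h₃⟩ := hpull w hw
  obtain ⟨U, hU⟩ := h₁ (m₁ + m₂ + m₃) (by omega)
  obtain ⟨V, hV⟩ := h₂ (m₁ + m₂ + m₃) (by omega)
  obtain ⟨W, hW⟩ := h₃ (m₁ + m₂ + m₃) (by omega)
  generalize m₁ + m₂ + m₃ = m at hU hV hW
  have hc1 : U * W = V ^ 2 := by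
    refine eq_of_aeval_eq_of_ne (L := AlgebraicClosure K) hn.ne_zero fun t ht => ?_
    rw [hevn] at ht
    have := (hconic _ (ψ ⟨_, mk_shiftGL_mem _ _ t ht⟩).2).1
    rw [map_mul, map_pow, ← hU t ht, ← hV t ht, ← hW t ht]
    linear_combination (aeval t (quadPoly (-e) f)) ^ m * (aeval t (quadPoly (-e) f)) ^ m * this
  have hc2 : U + C e' * V - C f' * W = quadPoly (-e) f ^ m := by
    refine eq_of_aeval_eq_of_ne (L := AlgebraicClosure K) hn.ne_zero fun t ht => ?_
    rw [hevn] at ht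
    have := (hconic _ (ψ ⟨_, mk_shiftGL_mem _ _ t ht⟩).2).2
    rw [map_sub, map_add, map_mul, map_mul, map_pow, ← hU t ht, ← hV t ht, ← hW t ht, aeval_C,
      aeval_C]
    linear_combination (aeval t (quadPoly (-e) f)) ^ m * this
  rcases exists_root_or_const_of_conic hQ hn m hc1 hc2 with ⟨z, hz⟩ | ⟨a, b, c, rfl, rfl, rfl⟩
  · obtain ⟨σ⟩ := nonempty_algEquiv_of_root (finrank_adjoinRoot_quadPoly (-e) f) hP
      (x := -AdjoinRoot.root (quadPoly (-e) f)) (by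
        have : aeval (AdjoinRoot.root (quadPoly (-e) f)) (quadPoly (-e) f) = 0 := by
          rw [AdjoinRoot.aeval_eq, AdjoinRoot.mk_self]
        rw [aeval_quadPoly, map_neg] at this
        linear_combination this)
    obtain ⟨τ⟩ := nonempty_algEquiv_of_root (finrank_adjoinRoot_quadPoly (-e) f) hQ hz
    exact ⟨σ.trans τ.symm⟩
  · exfalso
    classical
    have hf := irreducible_quadPoly_ne_zero hP
    have ht0 : (0 : AlgebraicClosure K) ^ 2 + algebraMap K _ e * 0 - algebraMap K _ f ≠ 0 := by
      simpa using hf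
    -- Constant coordinates would identify the classes of `C_P` and `tI + C_P`: entry `(1, 0)` gives
    -- the scalar `1`, and entry `(0, 0)` then gives `t = 0`.
    obtain ⟨t, ht⟩ := Infinite.exists_notMem_finset
      (insert 0 ((quadPoly (-e) f).map (algebraMap K (AlgebraicClosure K))).roots.toFinset)
    rw [Finset.mem_insert, not_or, Multiset.mem_toFinset, mem_roots
      (Polynomial.map_ne_zero hn.ne_zero), IsRoot.def, eval_map_algebraMap, hevn] at ht
    obtain ⟨htne, ht⟩ := ht
    have hval : ∀ (g : PGL(2, AlgebraicClosure K) → AlgebraicClosure K) (k : K),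
        (∀ (t : AlgebraicClosure K) (ht : _ ≠ 0), g (ψ ⟨_, mk_shiftGL_mem _ _ t ht⟩) *
          (aeval t (quadPoly (-e) f)) ^ m = aeval t (C k * quadPoly (-e) f ^ m)) →
        g (ψ ⟨_, mk_shiftGL_mem _ _ t ht⟩) = g (ψ ⟨_, mk_shiftGL_mem _ _ 0 ht0⟩) := by
      intro g k hg
      have key : ∀ (t : AlgebraicClosure K) (ht : _ ≠ 0),
          g (ψ ⟨_, mk_shiftGL_mem _ _ t ht⟩) = algebraMap K _ k := by
        intro t ht
        have := hg t ht
        rw [map_mul, aeval_C, map_pow] at this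
        refine mul_right_cancel₀ (pow_ne_zero m ?_) this
        rwa [hevn]
      rw [key, key]
    have heq := hinj _ (ψ ⟨_, mk_shiftGL_mem _ _ t ht⟩).2 _ (ψ ⟨_, mk_shiftGL_mem _ _ 0 ht0⟩).2
      (hval u a hU) (hval v b hV) (hval w c hW)
    have heq' := congrArg Subtype.val (ψ.injective (Subtype.ext heq))
    simp only at heq'
    obtain ⟨r, -, hr⟩ := mk_eq_mk_iff.1 heq'
    rw [coe_shiftGL, coe_shiftGL] at hr
    have h10 := congrFun₂ hr 1 0
    have h00 := congrFun₂ hr 0 0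
    simp at h10 h00
    rw [← h10] at h00
    simp at h00
    exact htne h00

end PullBack

theorem compGroup_tfae {K : Type*} [Field K] {e f e' f' : K} (hP : Irreducible (quadPoly e f))
    (hQ : Irreducible (quadPoly e' f')) :
    List.TFAE [
      AreConj (compGroup e f) (compGroup e' f'),
      AreKIsomorphic K (compAlgGroup e f) (compAlgGroup e' f'),
      Nonempty (AdjoinRoot (quadPoly e f) ≃ₐ[K] AdjoinRoot (quadPoly e' f'))] := by
  tfae_have 1 → 2 := areKIsomorphic_of_areConj (irreducible_quadPoly_ne_zero hP)
  tfae_have 2 → 3 := nonempty_algEquiv_of_areKIsomorphic hP hQ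
  tfae_have 3 → 1 := areConj_of_algEquiv hP hQ
  tfae_finish

/-! ### `K`-Borel subgroups over infinite fields -/

section KBorelSubgroups

variable {K : Type*} [Field K]

/-- The condition of commuting with `C_P` is linear and cuts out exactly the plane of the matrices
`aI + bC_P`. -/
theorem isClosed_compGroup (e f : K) :
    IsClosed[kTopology K] (compGroup e f : Set (PGL(2, K))) := by
  convert isClosed_setOf_linearMap (mulSubMul (companion e f) (companion e f)) using 1
  ext x
  obtain ⟨N, rfl⟩ := ProjGenLinGroup.mk_surjective x
  rw [SetLike.mem_coe, mk_mem_compGroup_iff]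
  simp only [mulSubMul_eq_zero, Set.mem_ofPred_eq]
  constructor
  · rintro ⟨x, y, h⟩
    refine ⟨N, rfl, ?_⟩
    simp [h, add_mul, mul_add]
  · rintro ⟨N', h, hN'⟩
    obtain ⟨x, y, h'⟩ := exists_eq_of_commute (companion_ne_smul_one e f) hN'
    exact mk_mem_compGroup_iff.1 (h ▸ mk_mem_compGroup h')

theorem IsRegular.exists_mvPolynomial (e f : K) {h : PGL(2, K) → K} (hh : IsRegular K h) :
    ∃ (m : ℕ) (F : MvPolynomial (Fin 2) K), ∀ (N : GL (Fin 2) K) (a b : K),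
      N.val = a • (1 : Matrix (Fin 2) (Fin 2) K) + b • companion e f →
        h (ProjGenLinGroup.mk N) * N.val.det ^ m = MvPolynomial.eval ![a, b] F := by
  obtain ⟨m, F, hF, hh⟩ := hh
  let Q : Matrix (Fin 2) (Fin 2) (MvPolynomial (Fin 2) K) :=
    !![MvPolynomial.X 0, MvPolynomial.X 1 * MvPolynomial.C f;
      MvPolynomial.X 1, MvPolynomial.X 0 + MvPolynomial.X 1 * MvPolynomial.C e]
  refine ⟨m, MvPolynomial.aeval (fun p => Q p.1 p.2) F, fun N a b hN => ?_⟩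
  rw [hh, evalFrac, div_mul_cancel₀ _ (pow_ne_zero _ (det_ne_zero_GL N)),
    ← MvPolynomial.coe_aeval_eq_eval]
  have : MvPolynomial.aeval ![a, b] (MvPolynomial.aeval (fun p => Q p.1 p.2) F) =
      MvPolynomial.aeval (fun p : Fin 2 × Fin 2 => MvPolynomial.aeval ![a, b] (Q p.1 p.2)) F := by
    rw [← AlgHom.comp_apply, MvPolynomial.comp_aeval]
  refine Eq.trans ?_ this.symm
  congr 2
  rw [hN, smul_one_add_smul_companion]
  funext ⟨i, j⟩
  fin_cases i <;> fin_cases j <;> simp [Q]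

/-- `G_P` is the image of the locus `D ≠ 0` in the plane, `D` being the norm form. If `h` and `k`
cut out closed sets covering `G_P`, their numerators satisfy `F G D = 0` on `K²`, hence as
polynomials because `K` is infinite. So `F` or `G` is zero: `G_P` is even irreducible. -/
theorem isPreconnected_compGroup [Infinite K] (e f : K) :
    @IsPreconnected _ (kTopology K) (compGroup e f : Set (PGL(2, K))) := by
  let _ := kTopology K
  rw [isPreconnected_iff_subset_of_disjoint_closed]
  intro Z₁ Z₂ hZ₁ hZ₂ hsub _
  obtain ⟨S, hS, rfl⟩ := isClosed_kTopology_iff.1 hZ₁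
  obtain ⟨T, hT, rfl⟩ := isClosed_kTopology_iff.1 hZ₂
  by_contra! hcon
  obtain ⟨h₁, h₂⟩ := hcon
  simp only [Set.not_subset, zeroSet, Set.mem_ofPred_eq, not_forall] at h₁ h₂
  obtain ⟨x, hx, h, hhS, hhx⟩ := h₁
  obtain ⟨y, hy, k, hkT, hky⟩ := h₂
  obtain ⟨m, F, hF⟩ := (hS h hhS).exists_mvPolynomial e f
  obtain ⟨n, G, hG⟩ := (hT k hkT).exists_mvPolynomial e f
  let D : MvPolynomial (Fin 2) K := MvPolynomial.X 0 ^ 2 +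
    MvPolynomial.X 0 * MvPolynomial.X 1 * MvPolynomial.C e - MvPolynomial.X 1 ^ 2 * MvPolynomial.C f
  have hD : ∀ v : Fin 2 → K, MvPolynomial.eval v D =
      (v 0 • (1 : Matrix (Fin 2) (Fin 2) K) + v 1 • companion e f).det := by
    intro v
    rw [det_smul_add_smul, trace_companion, det_companion]
    simp [D]
    ring
  have hprod : F * G * D = 0 := by
    refine MvPolynomial.funext fun v => ?_
    rw [map_mul, map_mul, map_zero]
    by_cases hv : MvPolynomial.eval v D = 0
    · rw [hv, mul_zero]
    · rw [hD] at hv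
      let N : GL (Fin 2) K := GeneralLinearGroup.mkOfDetNeZero _ hv
      have hN : N.val = v 0 • (1 : Matrix (Fin 2) (Fin 2) K) + v 1 • companion e f := rfl
      have hv' : v = ![v 0, v 1] := by
        ext i
        fin_cases i <;> rfl
      rw [hv', ← hF N _ _ hN, ← hG N _ _ hN]
      rcases hsub (mk_mem_compGroup hN) with h0 | h0
      · rw [h0 h hhS, zero_mul, zero_mul, zero_mul]
      · rw [h0 k hkT, zero_mul, mul_zero, zero_mul]
  have hD0 : D ≠ 0 := by
    intro h0
    have := hD ![1, 0]
    rw [h0] at this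
    simp at this
  rcases mul_eq_zero.1 ((mul_eq_zero.1 hprod).resolve_right hD0) with rfl | rfl
  · obtain ⟨N, rfl⟩ := ProjGenLinGroup.mk_surjective x
    obtain ⟨a, b, hN⟩ := mk_mem_compGroup_iff.1 hx
    have := hF N a b hN
    rw [map_zero, mul_eq_zero] at this
    exact this.elim hhx (pow_ne_zero _ (det_ne_zero_GL N))
  · obtain ⟨N, rfl⟩ := ProjGenLinGroup.mk_surjective y
    obtain ⟨a, b, hN⟩ := mk_mem_compGroup_iff.1 hy
    have := hG N a b hN
    rw [map_zero, mul_eq_zero] at this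
    exact this.elim hky (pow_ne_zero _ (det_ne_zero_GL N))

theorem commute_of_mk_mem_compGroup {e f : K} {M N : GL (Fin 2) K}
    (hM : ProjGenLinGroup.mk M ∈ compGroup e f) (hN : ProjGenLinGroup.mk N ∈ compGroup e f) :
    M * N = N * M := by
  obtain ⟨x, y, hM⟩ := mk_mem_compGroup_iff.1 hM
  obtain ⟨z, w, hN⟩ := mk_mem_compGroup_iff.1 hN
  apply Units.ext
  rw [Units.val_mul, Units.val_mul, hM, hN]
  simp only [add_mul, mul_add, Matrix.smul_mul, Matrix.mul_smul, one_mul, mul_one, smul_smul,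
    mul_comm z, mul_comm w]
  abel

theorem isSolvable_compGroup (e f : K) : Group.IsSolvable (compGroup e f) := by
  refine Group.isSolvable_of_comm fun a b => Subtype.ext ?_
  obtain ⟨a, ha⟩ := a
  obtain ⟨b, hb⟩ := b
  obtain ⟨M, rfl⟩ := ProjGenLinGroup.mk_surjective a
  obtain ⟨N, rfl⟩ := ProjGenLinGroup.mk_surjective b
  change ProjGenLinGroup.mk M * ProjGenLinGroup.mk N = ProjGenLinGroup.mk N * ProjGenLinGroup.mk M
  rw [← map_mul, commute_of_mk_mem_compGroup ha hb, map_mul]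

theorem isClosedConnectedSolvable_compGroup [Infinite K] (e f : K) :
    IsClosedConnectedSolvable (compGroup e f) where
  isClosed := isClosed_compGroup e f
  isConnected := ⟨⟨1, one_mem _⟩, isPreconnected_compGroup e f⟩
  isSolvable := isSolvable_compGroup e f

theorem IsClosedConnectedSolvable.isPreconnected {B : Subgroup (PGL(2, K))}
    (hB : IsClosedConnectedSolvable B) :
    @IsPreconnected _ (kTopology K) (B : Set (PGL(2, K))) :=
  hB.isConnected.2

theorem IsClosedConnectedSolvable.map_conj {B : Subgroup (PGL(2, K))}
    (hB : IsClosedConnectedSolvable B) (u : PGL(2, K)) :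
    IsClosedConnectedSolvable (B.map (MulAut.conj u).toMonoidHom) where
  isClosed := by
    let _ := kTopology K
    convert hB.isClosed.preimage (continuous_mul_mul u⁻¹ u) using 1
    ext x
    constructor
    · rintro ⟨b, hb, rfl⟩
      simpa [mul_assoc] using hb
    · intro hx
      exact ⟨_, hx, by simp [mul_assoc]⟩
  isConnected := by
    let _ := kTopology K
    exact hB.isConnected.image _ (continuous_mul_mul u u⁻¹).continuousOn
  isSolvable := by
    have := hB.isSolvable
    exact Group.isSolvable_of_surjective
      (f := (B.equivMapOfInjective _ (MulAut.conj u).injective).toMonoidHom)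
      (B.equivMapOfInjective _ (MulAut.conj u).injective).surjective

/-- A triangular conjugate of `C_P` would have a root of `P` on its diagonal. -/
theorem not_isTriangularisable_compGroup {e f : K} (hP : Irreducible (quadPoly e f)) :
    ¬ IsTriangularisable (compGroup e f) := by
  rintro ⟨u, hu⟩
  obtain ⟨U, rfl⟩ := ProjGenLinGroup.mk_surjective u
  obtain ⟨M, hM, hMU⟩ := hu _ (mk_companionGL_mem e (irreducible_quadPoly_ne_zero hP))
  rw [← map_inv, ← map_mul, ← map_mul] at hMU
  obtain ⟨c, -, hc⟩ := mk_eq_mk_iff.1 hMU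
  have h10 := congrFun₂ hc 1 0
  have htr := Matrix.trace_units_conj U (companion e f)
  have hdet := Matrix.det_units_conj U (companion e f)
  rw [Units.val_mul, Units.val_mul, coe_companionGL, Matrix.smul_apply, hM, smul_zero] at h10
  rw [Matrix.trace_fin_two, trace_companion] at htr
  rw [Matrix.det_fin_two, det_companion, h10] at hdet
  refine irreducible_quadPoly_iff.1 hP ((U.val * companion e f * (U⁻¹).val) 0 0) ?_
  linear_combination (U.val * companion e f * (U⁻¹).val) 0 0 * htr - hdet

theorem isTriangularisable_of_isConjInto_affOne {B : Subgroup (PGL(2, K))}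
    (h : IsConjInto B (affOne K)) : IsTriangularisable B := by
  obtain ⟨u, hu⟩ := h.exists_forall
  refine ⟨u, fun g hg => ?_⟩
  obtain ⟨a, b, M, hM, h⟩ := hu g hg
  exact ⟨M, by simp [hM], h⟩

theorem IsTriangularisable.mono {B B' : Subgroup (PGL(2, K))} (h : IsTriangularisable B')
    (hle : B ≤ B') : IsTriangularisable B :=
  h.imp fun _ hu g hg => hu g (hle hg)

/-- A closed connected solvable `B` containing `G_P` does not go into `Aff₁`, since `G_P` is not
triangularisable. So it goes into some `G_{P'}`, where even the lifts commute; lifts from `B`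
therefore commute with `C_P`. -/
theorem isKBorel_compGroup [Infinite K] {e f : K} (hP : Irreducible (quadPoly e f)) :
    IsKBorel (compGroup e f) := by
  refine ⟨isClosedConnectedSolvable_compGroup e f, fun B hB hle => ?_⟩
  rcases isConjInto_affOne_or_compGroup hB.isPreconnected hB.isSolvable with
    h | ⟨e', f', -, h⟩
  · exact absurd ((isTriangularisable_of_isConjInto_affOne h).mono hle)
      (not_isTriangularisable_compGroup hP)
  · obtain ⟨u, hu⟩ := h.exists_forall
    obtain ⟨U, rfl⟩ := ProjGenLinGroup.mk_surjective u
    intro b hb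
    obtain ⟨N, rfl⟩ := ProjGenLinGroup.mk_surjective b
    have hf := irreducible_quadPoly_ne_zero hP
    have h1 := hu _ hb
    have h2 := hu _ (hle (mk_companionGL_mem e hf))
    rw [← map_inv, ← map_mul, ← map_mul] at h1 h2
    have hcomm := commute_of_mk_mem_compGroup h1 h2
    have hcomm' : N * companionGL e hf = companionGL e hf * N := by
      simpa [mul_assoc] using congrArg (fun X => U⁻¹ * X * U) hcomm
    obtain ⟨x, y, hN⟩ := exists_eq_of_commute (companion_ne_smul_one e f)
      (congrArg Units.val hcomm')
    exact mk_mem_compGroup hN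

theorem exists_areConj_compGroup [Infinite K] {B : Subgroup (PGL(2, K))} (hB : IsKBorel B)
    (ht : ¬ IsTriangularisable B) :
    ∃ e f : K, Irreducible (quadPoly e f) ∧ AreConj B (compGroup e f) := by
  rcases isConjInto_affOne_or_compGroup hB.prop.isPreconnected hB.prop.isSolvable with
    h | ⟨e, f, hP, h⟩
  · exact absurd (isTriangularisable_of_isConjInto_affOne h) ht
  · obtain ⟨u, hu⟩ := h.exists_forall
    refine ⟨e, f, hP, u, le_antisymm ?_ fun g hg => ?_⟩
    · rintro _ ⟨b, hb, rfl⟩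
      exact hu b hb
    · have hle := hB.2 ((isClosedConnectedSolvable_compGroup e f).map_conj u⁻¹)
        (fun b hb => ⟨_, hu b hb, by simp [mul_assoc]⟩)
      exact ⟨_, hle ⟨g, hg, rfl⟩, by simp [mul_assoc]⟩

end KBorelSubgroups

/-! ### Conjugacy classes of Borel subgroups and quadratic extensions. -/

section Correspondence

universe u

variable {K : Type u} [Field K]

/-- The quadratic extension `K[T] / P`. -/
noncomputable def quadExtOf (e f : K) (hP : Irreducible (quadPoly e f)) : QuadExt K :=
  have := Fact.mk hP
  { carrier := AdjoinRoot (quadPoly e f)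
    finrank_eq_two := finrank_adjoinRoot_quadPoly e f }

/-- A polynomial is chosen for each `B`. `compGroup_tfae` makes the resulting extension well defined
and injective on classes; surjectivity holds because every quadratic extension is some `K[T]/P` and
`G_P` is a Borel subgroup. -/
theorem exists_correspondence [Infinite K] :
    ∃ Φ : Quotient (conjSetoid K) ≃ Quotient (isoSetoid K),
      ∀ (B : NontrivialKBorel K) (E : QuadExt K),
        Φ (Quotient.mk (conjSetoid K) B) = Quotient.mk (isoSetoid K) E ↔
          ∃ e f : K, Irreducible (quadPoly e f) ∧ AreConj B.1 (compGroup e f) ∧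
            Nonempty (E.carrier ≃ₐ[K] AdjoinRoot (quadPoly e f)) := by
  have hex : ∀ B : NontrivialKBorel K, ∃ e f : K, Irreducible (quadPoly e f) ∧
      AreConj B.1 (compGroup e f) := fun B => exists_areConj_compGroup B.2.1 B.2.2
  choose e f hirr hconj using hex
  have symm {H H' : Subgroup (PGL(2, K))} (h : AreConj H H') : AreConj H' H :=
    (AreConj.equivalence _).symm h
  have trans {H H' H'' : Subgroup (PGL(2, K))} (h : AreConj H H') (h' : AreConj H' H'') :
    AreConj H H'' := (AreConj.equivalence _).trans h h'
  have hiff : ∀ (B : NontrivialKBorel K) (a b : K), Irreducible (quadPoly a b) →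
      (AreConj B.1 (compGroup a b) ↔
        Nonempty (AdjoinRoot (quadPoly (e B) (f B)) ≃ₐ[K] AdjoinRoot (quadPoly a b))) := by
    intro B a b hab
    have h : AreConj (compGroup (e B) (f B)) (compGroup a b) ↔ Nonempty
        (AdjoinRoot (quadPoly (e B) (f B)) ≃ₐ[K] AdjoinRoot (quadPoly a b)) :=
      (compGroup_tfae (hirr B) hab).out 0 2
    rw [← h]
    exact ⟨trans (symm (hconj B)), trans (hconj B)⟩
  have hiff' : ∀ B B' : NontrivialKBorel K, AreConj B.1 B'.1 ↔
      Nonempty (AdjoinRoot (quadPoly (e B) (f B)) ≃ₐ[K] AdjoinRoot (quadPoly (e B') (f B'))) := by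
    intro B B'
    rw [← hiff B _ _ (hirr B')]
    exact ⟨fun h => trans h (hconj B'), fun h => trans h (symm (hconj B'))⟩
  let φ : Quotient (conjSetoid K) → Quotient (isoSetoid K) :=
    Quotient.map (fun B => quadExtOf (e B) (f B) (hirr B)) fun B B' h => (hiff' B B').1 h
  have hφ : Function.Bijective φ := by
    constructor
    · intro p q
      refine Quotient.inductionOn₂ p q fun B B' h => ?_
      exact Quotient.sound ((hiff' B B').2 (Quotient.exact h))
    · intro q
      refine Quotient.inductionOn q fun E => ?_
      obtain ⟨a, b, hab, ⟨σ⟩⟩ := exists_irreducible_quadPoly_algEquiv E.finrank_eq_two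
      let B : NontrivialKBorel K :=
        ⟨compGroup a b, isKBorel_compGroup hab, not_isTriangularisable_compGroup hab⟩
      -- The polynomial chosen for this `B` may differ from the one defining it; `τ` compares their
      -- extensions.
      obtain ⟨τ⟩ := (hiff B a b hab).1 ((AreConj.equivalence _).refl _)
      exact ⟨Quotient.mk _ B, Quotient.sound ⟨τ.trans σ⟩⟩
  refine ⟨Equiv.ofBijective φ hφ, fun B E => ⟨fun h => ?_, ?_⟩⟩
  · obtain ⟨σ⟩ : Nonempty (AdjoinRoot (quadPoly (e B) (f B)) ≃ₐ[K] E.carrier) := Quotient.exact h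
    exact ⟨e B, f B, hirr B, hconj B, ⟨σ.symm⟩⟩
  · rintro ⟨a, b, hab, hB, ⟨σ⟩⟩
    obtain ⟨τ⟩ := (hiff B a b hab).1 hB
    exact Quotient.sound ⟨τ.trans σ.symm⟩

end Correspondence

/-! ### Characteristic different from two -/

section CharNeTwo

variable {K : Type*} [Field K]

theorem quadPoly_zero (f : K) : quadPoly 0 f = X ^ 2 - C f := by
  simp [quadPoly]

theorem irreducible_quadPoly_zero_iff {f : K} : Irreducible (quadPoly 0 f) ↔ ¬ IsSquare f := by
  rw [irreducible_quadPoly_iff, IsSquare, not_exists]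
  refine forall_congr' fun x => not_congr ?_
  rw [zero_mul, sub_zero, sub_eq_zero, pow_two, eq_comm]

theorem compAlgGroup_zero (f : K) : compAlgGroup 0 f = torusAlgGroup f := by
  rw [compAlgGroup, torusAlgGroup, torus, map_zero]

/-- Completing the square: a root of `P` minus `e / 2` squares to `f + (e / 2) ^ 2`. -/
theorem exists_areConj_torus (h2 : (2 : K) ≠ 0) {e f : K} (hP : Irreducible (quadPoly e f)) :
    ∃ g : K, ¬ IsSquare g ∧ AreConj (compGroup e f) (torus g) := by
  have hg : Irreducible (quadPoly 0 (f + (e / 2) ^ 2)) := by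
    rw [irreducible_quadPoly_iff] at hP ⊢
    intro x hx
    apply hP (x + e / 2)
    field_simp at hx ⊢
    linear_combination hx
  have := Fact.mk hP
  refine ⟨_, irreducible_quadPoly_zero_iff.1 hg, areConj_of_algEquiv hP hg ?_⟩
  obtain ⟨σ⟩ := nonempty_algEquiv_of_root (finrank_adjoinRoot_quadPoly e f) hg
    (x := AdjoinRoot.root (quadPoly e f) - algebraMap K _ (e / 2)) (by
      have h : aeval (AdjoinRoot.root (quadPoly e f)) (quadPoly e f) = 0 := by
        rw [AdjoinRoot.aeval_eq, AdjoinRoot.mk_self]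
      rw [aeval_quadPoly] at h
      have he : algebraMap K (AdjoinRoot (quadPoly e f)) e = 2 * algebraMap K _ (e / 2) := by
        rw [← map_ofNat (algebraMap K (AdjoinRoot (quadPoly e f))) 2, ← map_mul,
          mul_div_cancel₀ _ h2]
      rw [map_zero, map_add, map_pow]
      linear_combination h + AdjoinRoot.root (quadPoly e f) * he)
  exact ⟨σ.symm⟩

/-- A conjugate of `C_f` has the form `x + y C_g`. Its trace gives `2x = 0`, so `x = 0`, and its
determinant gives `f = y² g`. -/
theorem isSquare_div_of_areConj (h2 : (2 : K) ≠ 0) {f g : K} (hf : ¬ IsSquare f)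
    (hg : ¬ IsSquare g) (h : AreConj (torus f) (torus g)) : IsSquare (f / g) := by
  have hf0 : f ≠ 0 := by rintro rfl; exact hf (IsSquare.zero)
  have hg0 : g ≠ 0 := by rintro rfl; exact hg (IsSquare.zero)
  obtain ⟨V, x, y, -, hV⟩ := AreConj.exists_mul_companion_eq hf0 h
  have hV' : V.val * companion 0 f * (V⁻¹).val =
      x • (1 : Matrix (Fin 2) (Fin 2) K) + y • companion 0 g := by
    rw [hV, Units.mul_inv_cancel_right]
  have htr := Matrix.trace_units_conj V (companion 0 f)
  have hdet := Matrix.det_units_conj V (companion 0 f)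
  rw [hV', trace_smul_add_smul, trace_companion, trace_companion, mul_zero, add_zero,
    mul_eq_zero] at htr
  rw [hV', htr.resolve_left h2, det_smul_add_smul, trace_companion, det_companion,
    det_companion] at hdet
  refine ⟨y, ?_⟩
  rw [div_eq_iff hg0]
  linear_combination hdet

theorem nonempty_algEquiv_of_isSquare_div {f g : K} (hf : ¬ IsSquare f)
    (hg : ¬ IsSquare g) (h : IsSquare (f / g)) :
    Nonempty (AdjoinRoot (quadPoly 0 f) ≃ₐ[K] AdjoinRoot (quadPoly 0 g)) := by
  have hg0 : g ≠ 0 := by rintro rfl; exact hg (IsSquare.zero)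
  obtain ⟨r, hr⟩ := h
  rw [div_eq_iff hg0] at hr
  have := Fact.mk (irreducible_quadPoly_zero_iff.2 hg)
  refine nonempty_algEquiv_of_root (finrank_adjoinRoot_quadPoly 0 g)
    (irreducible_quadPoly_zero_iff.2 hf)
    (x := algebraMap K _ r * AdjoinRoot.root (quadPoly 0 g)) ?_
  have h : aeval (AdjoinRoot.root (quadPoly 0 g)) (quadPoly 0 g) = 0 := by
    rw [AdjoinRoot.aeval_eq, AdjoinRoot.mk_self]
  rw [aeval_quadPoly, map_zero] at h
  rw [hr, map_zero, map_mul, map_mul]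
  linear_combination algebraMap K _ r ^ 2 * h

theorem torus_tfae (h2 : (2 : K) ≠ 0) {f g : K} (hf : ¬ IsSquare f) (hg : ¬ IsSquare g) :
    List.TFAE [
      AreConj (torus f) (torus g),
      AreKIsomorphic K (torusAlgGroup f) (torusAlgGroup g),
      Nonempty (AdjoinRoot (X ^ 2 - C f : K[X]) ≃ₐ[K] AdjoinRoot (X ^ 2 - C g : K[X])),
      IsSquare (f / g)] := by
  have h := compGroup_tfae (irreducible_quadPoly_zero_iff.2 hf) (irreducible_quadPoly_zero_iff.2 hg)
  have h43 := nonempty_algEquiv_of_isSquare_div hf hg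
  rw [compAlgGroup_zero, compAlgGroup_zero] at h
  rw [quadPoly_zero, quadPoly_zero] at h h43
  tfae_have 1 ↔ 2 := h.out 0 1
  tfae_have 1 ↔ 3 := h.out 0 2
  tfae_have 1 → 4 := isSquare_div_of_areConj h2 hf hg
  tfae_have 4 → 3 := h43
  tfae_finish

end CharNeTwo

/-! ### Transport along conjugacy, anisotropy of the norm form, and the final statement. -/

theorem IsConjInto.trans_areConj {G : Type*} [Group G] {H H' H'' : Subgroup G}
    (h : IsConjInto H H') (h' : AreConj H' H'') : IsConjInto H H'' := by
  obtain ⟨u, hu⟩ := h.exists_forall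
  obtain ⟨v, rfl⟩ := h'
  refine isConjInto_of_forall (v * u) fun b hb => ⟨_, hu b hb, ?_⟩
  simp [mul_assoc]

/-- For `b ≠ 0` the determinant is `b² P(-a/b)`, which is nonzero because `P` has no root. -/
theorem exists_GL_eq_smul_add_smul {K : Type*} [Field K] {e f : K}
    (hP : Irreducible (quadPoly e f)) {a b : K} (hab : (a, b) ≠ (0, 0)) :
    ∃ M : GL (Fin 2) K, M.val = a • (1 : Matrix (Fin 2) (Fin 2) K) + b • companion e f ∧
      ProjGenLinGroup.mk M ∈ compGroup e f := by
  have hdet : (a • (1 : Matrix (Fin 2) (Fin 2) K) + b • companion e f).det ≠ 0 := by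
    rw [det_smul_add_smul, trace_companion, det_companion]
    intro h
    by_cases hb : b = 0
    · subst hb
      have ha : a = 0 := by simpa using h
      exact hab (by rw [ha])
    · apply irreducible_quadPoly_iff.1 hP (-a / b)
      field_simp
      linear_combination h
  exact ⟨GeneralLinearGroup.mkOfDetNeZero _ hdet, rfl, mk_mem_compGroup rfl⟩

end KBorel

theorem mainTheorem11 (K : Type*) [Field K] :
    -- arbitrary fields: for `P` irreducible, every `p(a I + b C_P)` makes sense, so that
    -- `G_P = {p(a I + b C_P)}` is a subgroup
    (∀ e f : K, Irreducible (KBorel.quadPoly e f) →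
      ∀ a b : K, (a, b) ≠ (0, 0) →
        ∃ M : GL (Fin 2) K,
          (M : Matrix (Fin 2) (Fin 2) K) = a • (1 : Matrix (Fin 2) (Fin 2) K)
            + b • KBorel.companion e f ∧
          Matrix.ProjGenLinGroup.mk M ∈ KBorel.compGroup e f) ∧
    (∀ B : Subgroup (Matrix.ProjGenLinGroup (Fin 2) K), KBorel.IsClosedConnectedSolvable B →
      KBorel.IsConjInto B (KBorel.affOne K) ∨
        ∃ e f : K, Irreducible (KBorel.quadPoly e f) ∧
          KBorel.IsConjInto B (KBorel.compGroup e f)) ∧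
    (∀ e f e' f' : K, Irreducible (KBorel.quadPoly e f) → Irreducible (KBorel.quadPoly e' f') →
      List.TFAE [
        KBorel.AreConj (KBorel.compGroup e f) (KBorel.compGroup e' f'),
        KBorel.AreKIsomorphic K (KBorel.compAlgGroup e f) (KBorel.compAlgGroup e' f'),
        Nonempty (AdjoinRoot (KBorel.quadPoly e f) ≃ₐ[K] AdjoinRoot (KBorel.quadPoly e' f'))]) ∧
    -- infinite fields: the correspondence with quadratic extensions
    (Infinite K →
      (∀ e f : K, Irreducible (KBorel.quadPoly e f) →
        KBorel.IsKBorel (KBorel.compGroup e f) ∧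
          ¬ KBorel.IsTriangularisable (KBorel.compGroup e f)) ∧
      ∃ Φ : Quotient (KBorel.conjSetoid K) ≃ Quotient (KBorel.isoSetoid K),
        ∀ (B : KBorel.NontrivialKBorel K) (E : KBorel.QuadExt K),
          Φ (Quotient.mk (KBorel.conjSetoid K) B) = Quotient.mk (KBorel.isoSetoid K) E ↔
            ∃ e f : K, Irreducible (KBorel.quadPoly e f) ∧
              KBorel.AreConj B.1 (KBorel.compGroup e f) ∧
              Nonempty (E.carrier ≃ₐ[K] AdjoinRoot (KBorel.quadPoly e f))) ∧
    -- characteristic different from `2`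
    (ringChar K ≠ 2 →
      (∀ B : Subgroup (Matrix.ProjGenLinGroup (Fin 2) K), KBorel.IsClosedConnectedSolvable B →
        KBorel.IsConjInto B (KBorel.affOne K) ∨
          ∃ f : K, ¬ IsSquare f ∧ KBorel.IsConjInto B (KBorel.torus f)) ∧
      (∀ f g : K, ¬ IsSquare f → ¬ IsSquare g →
        List.TFAE [
          KBorel.AreConj (KBorel.torus f) (KBorel.torus g),
          KBorel.AreKIsomorphic K (KBorel.torusAlgGroup f) (KBorel.torusAlgGroup g),
          Nonempty (AdjoinRoot (Polynomial.X ^ 2 - Polynomial.C f : Polynomial K) ≃ₐ[K]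
            AdjoinRoot (Polynomial.X ^ 2 - Polynomial.C g : Polynomial K)),
          IsSquare (f / g)])) := by
  refine ⟨fun e f hP a b hab => KBorel.exists_GL_eq_smul_add_smul hP hab,
    fun B hB => KBorel.isConjInto_affOne_or_compGroup hB.isPreconnected hB.isSolvable,
    fun e f e' f' hP hQ => KBorel.compGroup_tfae hP hQ, fun _ =>
    ⟨fun e f hP => ⟨KBorel.isKBorel_compGroup hP, KBorel.not_isTriangularisable_compGroup hP⟩,
      KBorel.exists_correspondence⟩, fun hchar => ?_⟩
  have h2 : (2 : K) ≠ 0 := Ring.two_ne_zero hchar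
  refine ⟨fun B hB => ?_, fun f g hf hg => KBorel.torus_tfae h2 hf hg⟩
  refine (KBorel.isConjInto_affOne_or_compGroup hB.isPreconnected hB.isSolvable).imp_right ?_
  rintro ⟨e, f, hP, h⟩
  obtain ⟨g, hg, hconj⟩ := KBorel.exists_areConj_torus h2 hP
  exact ⟨g, hg, h.trans_areConj hconj⟩
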